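/- Let $p\ge 2$, let $X$ be a random vector in $\mathbb R^p$ with $E\|X\|^2<\infty$ and covariance matrix $\Sigma$, let $\tilde Y$ be a random variable with values in $\{-1,1\}$, and let $\lambda>0$. For $\theta=(\psi^{\top},t)^{\top}\in\mathbb R^{p}\times\mathbb R$ and $Z=(X,\tilde Y)$ put $$m(\theta,Z)=\psi^{\top}\Sigma\psi+\lambda\,[\,1-\tilde Y(X^{\top}\psi-t)\,]^{+},\qquad X^*=(X^{\top},-1)^{\top}.$$ Suppose that $X$ has a convex and open support, that its conditional distributions given $\tilde Y=1$ and given $\tilde Y=-1$ are dominated by Lebesgue measure, and that for all linearly independent $\psi,\delta\in\mathbb R^p$ and each $\tilde y\in\{-1,1\}$ the conditional density $f_{\psi^{\top}X\mid\delta^{\top}X,\tilde Y}$ and the conditional expectation $E(X\mid\psi^{\top}X,\delta^{\top}X,\tilde Y)$ have versions with the following properties. 1. For every $v\in\mathbb R$ the function $u\mapsto E(X^*\mid\psi^{\top}X=u,\delta^{\top}X=v,\tilde Y=\tilde y)\,f_{\psi^{\top}X\mid\delta^{\top}X,\tilde Y}(u\mid v,\tilde y)$ is continuous. 2. For every $i=1,\dots,p$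 there is a nonnegative function $c_i(v,\tilde y)$ with $E[c_i(\delta^{\top}X,\tilde Y)\mid\tilde Y=\tilde y]<\infty$ such that $v\,E(X_i\mid\psi^{\top}X=u,\delta^{\top}X=v,\tilde Y=\tilde y)\,f_{\psi^{\top}X\mid\delta^{\top}X,\tilde Y}(u\mid v,\tilde y)\le c_i(v,\tilde y)$ for all $u,v\in\mathbb R$. 3. There is a nonnegative function $c_0(v,\tilde y)$ with $E[c_0(\delta^{\top}X,\tilde Y)\mid\tilde Y=\tilde y]<\infty$ such that $f_{\psi^{\top}X\mid\delta^{\top}X,\tilde Y}(u\mid v,\tilde y)\le c_0(v,\tilde y)$ for all $u,v\in\mathbb R$. Then $\theta\mapsto E[m(\theta,Z)]$ is differentiable at every $\theta=(\psi^{\top},t)^{\top}$ with $\psi\neq0$; for every $\psi\ne0$ and $\tilde y\in\{-1,1\}$ there are versions of $f_{\psi^{\top}X\mid\tilde Y}(\cdot\mid\tilde y)$ and of $E(X^*X^{*\top}\mid\psi^{\top}X=\cdot\,,\tilde Y=\tilde y)$ such that the density and the product of the two are continuous on $\mathbb R$; and, with any such versions, the gradient $\theta\mapsto D_\theta E[m(\theta,Z)]$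 is, at every $\theta$ with $\psi\ne0$, differentiable in all directions with derivative matrix $$H(\theta)=2\,\mathrm{diag}(\Sigma,0)+\lambda\sum_{\tilde y=-1,1}P(\tilde Y=\tilde y)\,f_{\psi^{\top}X\mid\tilde Y}(t+\tilde y\mid\tilde y)\,E(X^*X^{*\top}\mid\psi^{\top}X=t+\tilde y,\ \tilde Y=\tilde y),$$ that is, its directional derivative at $\theta$ in any direction $\eta\in\mathbb R^{p+1}$ is $H(\theta)\eta$. Furthermore, if for each $\tilde y\in\{-1,1\}$ the function $(\psi,t)\mapsto f_{\psi^{\top}X\mid\tilde Y}(t+\tilde y\mid\tilde y)\,E(X^*X^{*\top}\mid\psi^{\top}X=t+\tilde y,\tilde Y=\tilde y)$ is continuous on $\{\psi\neq0\}$, then $\theta\mapsto D_\theta E[m(\theta,Z)]$ is jointly (Fréchet) differentiable, with derivative $H(\theta)$, at every $\theta$ with $\psi\ne0$. -/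

import Mathlib

open MeasureTheory ProbabilityTheory
open scoped Matrix

noncomputable section

namespace PSVM

/-- The parameter space `ℝ^(p+1)` with coordinates `θ = (ψ, t)`, Euclidean norm. -/
abbrev Param (p : ℕ) : Type := EuclideanSpace ℝ (Fin p ⊕ Unit)

/-- The normal vector `ψ` of `θ = (ψ, t)`. -/
def normal {p : ℕ} (θ : Param p) : EuclideanSpace ℝ (Fin p) :=
  WithLp.toLp 2 (fun i => θ (Sum.inl i))

/-- The offset `t` of `θ = (ψ, t)`. -/
def offset {p : ℕ} (θ : Param p) : ℝ := θ (Sum.inr ())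

/-- The linear form `ψᵀ x`. -/
def lin {p : ℕ} (ψ x : EuclideanSpace ℝ (Fin p)) : ℝ := ∑ i, ψ i * x i

/-- The augmented vector `x* = (xᵀ, -1)ᵀ`. -/
def star {p : ℕ} (x : EuclideanSpace ℝ (Fin p)) : Fin p ⊕ Unit → ℝ :=
  Sum.elim (fun i => x i) (fun _ => -1)

/-- The matrix `diag(S, 0)`. -/
def augment {p : ℕ} (S : Matrix (Fin p) (Fin p) ℝ) : Matrix (Fin p ⊕ Unit) (Fin p ⊕ Unit) ℝ :=
  Matrix.fromBlocks S 0 0 0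

/-- The loss `m(θ, z) = ψᵀ S ψ + lam * [1 - y (xᵀ ψ - t)]⁺`, where `z = (x, y)`. -/
def loss {p : ℕ} (S : Matrix (Fin p) (Fin p) ℝ) (lam : ℝ) (θ : Param p)
    (x : EuclideanSpace ℝ (Fin p)) (y : ℝ) : ℝ :=
  (∑ i, ∑ j, normal θ i * S i j * normal θ j)
    + lam * max (1 - y * (lin (normal θ) x - offset θ)) 0

section Prob

variable {Ω : Type*} [MeasurableSpace Ω]

/-- The covariance matrix `Σ = var(X)`. -/
def covMat {p : ℕ} (P : Measure Ω) (X : Ω → EuclideanSpace ℝ (Fin p)) :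
    Matrix (Fin p) (Fin p) ℝ :=
  Matrix.of fun i j => cov[fun ω => X ω i, fun ω => X ω j; P]

/-- The population objective function `θ ↦ E[m(θ, Z)]`, `Z = (X, Y)`, with `S = var(X)`. -/
def risk {p : ℕ} (P : Measure Ω) (X : Ω → EuclideanSpace ℝ (Fin p)) (Y : Ω → ℝ) (lam : ℝ)
    (θ : Param p) : ℝ :=
  ∫ ω, loss (covMat P X) lam θ (X ω) (Y ω) ∂P

/-- The conditional probability `P( · | Y = y)` (the zero measure if `P(Y = y) = 0`). -/
def slice (P : Measure Ω) (Y : Ω → ℝ) (y : ℝ) : Measure Ω := P[|Y ⁻¹' {y}]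

/-- `f` is (a version of) the Lebesgue density of the random variable `U` under `μ`. -/
def IsDensity (μ : Measure Ω) (U : Ω → ℝ) (f : ℝ → ℝ) : Prop :=
  Measurable f ∧ (∀ u, 0 ≤ f u) ∧
    μ.map U = (volume : Measure ℝ).withDensity (fun u => ENNReal.ofReal (f u))

/-- `f u v` is (a version of) the conditional Lebesgue density `f_{U|V}(u | v)` under `μ`: the law
of `(V, U)` is `f u v du μ_V(dv)`, where `μ_V` is the law of `V`. -/
def IsCondDensity (μ : Measure Ω) (U V : Ω → ℝ) (f : ℝ → ℝ → ℝ) : Prop :=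
  Measurable (Function.uncurry f) ∧ (∀ u v, 0 ≤ f u v) ∧
    μ.map (fun ω => (V ω, U ω)) =
      ((μ.map V).prod (volume : Measure ℝ)).withDensity (fun z => ENNReal.ofReal (f z.2 z.1))

/-- `r` is (a version of) the regression function `g ↦ E(W | G = g)` under `μ`. -/
def IsCondMean {β : Type*} [MeasurableSpace β] (μ : Measure Ω) (W : Ω → ℝ) (G : Ω → β)
    (r : β → ℝ) : Prop :=
  Measurable r ∧
    (fun ω => r (G ω)) =ᵐ[μ] μ[W | MeasurableSpace.comap G inferInstance]

/-- The distribution of `X` has a convex and open support: it is carried by a convex open set all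
of whose points belong to its topological support. -/
def HasConvexOpenSupport {p : ℕ} (P : Measure Ω) (X : Ω → EuclideanSpace ℝ (Fin p)) : Prop :=
  ∃ S : Set (EuclideanSpace ℝ (Fin p)),
    IsOpen S ∧ Convex ℝ S ∧ P.map X Sᶜ = 0 ∧ S ⊆ (P.map X).support

/-- The regularity conditions on the conditional law of `U = ψᵀ X` given `V = δᵀ X` under
`μ = P( · | Y = y)`.  Here `f u v` is `f_{U|V}(u | v)` and `r u v` is `E(X | U = u, V = v)`, so
that `star (r u v)` is `E(X* | U = u, V = v)`. -/
def Regular {p : ℕ} (μ : Measure Ω) (X : Ω → EuclideanSpace ℝ (Fin p))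
    (ψ δ : EuclideanSpace ℝ (Fin p)) : Prop :=
  ∃ (f : ℝ → ℝ → ℝ) (r : ℝ → ℝ → EuclideanSpace ℝ (Fin p)),
    IsCondDensity μ (fun ω => lin ψ (X ω)) (fun ω => lin δ (X ω)) f ∧
    (∀ i, IsCondMean μ (fun ω => X ω i) (fun ω => (lin ψ (X ω), lin δ (X ω)))
      (fun z => r z.1 z.2 i)) ∧
    (∀ v, Continuous fun u => f u v • star (r u v)) ∧
    (∀ i, ∃ c : ℝ → ℝ, (∀ v, 0 ≤ c v) ∧ Integrable c (μ.map fun ω => lin δ (X ω)) ∧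
      ∀ u v, v * r u v i * f u v ≤ c v) ∧
    (∃ c₀ : ℝ → ℝ, (∀ v, 0 ≤ c₀ v) ∧ Integrable c₀ (μ.map fun ω => lin δ (X ω)) ∧
      ∀ u v, f u v ≤ c₀ v)

/-- `f` is a version of the density of `U = ψᵀ X` and `M` a version of `u ↦ E(X* X*ᵀ | U = u)`
under `μ = P( · | Y = y)`, chosen such that `f` and `f • M` are continuous.  The values
`f u • M u` are then uniquely determined for every `u`. -/
def IsContVersion {p : ℕ} (μ : Measure Ω) (X : Ω → EuclideanSpace ℝ (Fin p))
    (ψ : EuclideanSpace ℝ (Fin p)) (f : ℝ → ℝ)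
    (M : ℝ → Matrix (Fin p ⊕ Unit) (Fin p ⊕ Unit) ℝ) : Prop :=
  IsDensity μ (fun ω => lin ψ (X ω)) f ∧
  (∀ i j, IsCondMean μ (fun ω => star (X ω) i * star (X ω) j) (fun ω => lin ψ (X ω))
    (fun u => M u i j)) ∧
  Continuous f ∧ Continuous fun u => f u • M u

/-- The matrix
`2 diag(Σ, 0) + lam ∑_y P(Y = y) f_{ψᵀX|Y}(t + y | y) E(X* X*ᵀ | ψᵀX = t + y, Y = y)`, where
`f y ψ u` stands for `f_{ψᵀX|Y}(u | y)` and `M y ψ u` for `E(X* X*ᵀ | ψᵀX = u, Y = y)`. -/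
def hessian {p : ℕ} (P : Measure Ω) (X : Ω → EuclideanSpace ℝ (Fin p)) (Y : Ω → ℝ) (lam : ℝ)
    (f : ℝ → EuclideanSpace ℝ (Fin p) → ℝ → ℝ)
    (M : ℝ → EuclideanSpace ℝ (Fin p) → ℝ → Matrix (Fin p ⊕ Unit) (Fin p ⊕ Unit) ℝ)
    (θ : Param p) : Matrix (Fin p ⊕ Unit) (Fin p ⊕ Unit) ℝ :=
  (2 : ℝ) • augment (covMat P X)
    + lam • ∑ y ∈ ({-1, 1} : Finset ℝ), P.real (Y ⁻¹' {y}) •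
        (f y (normal θ) (offset θ + y) • M y (normal θ) (offset θ + y))

end Prob

end PSVM

end

/-!
The gradient of the objective function at `θ = (ψ, t)` is `2 diag(Σ, 0) θ` plus `lam` times a
weighted sum over the classes `y` of a constant minus the half-space moment
`E[X* 1{ψᵀ X ≤ t + y} | Y = y]` (`hasGradientAt_risk`); it exists because `ψᵀ X` has a density and
hence no atoms.  Everything reduces to differentiating half-space moments in a direction
`η = (δ, s)`, within one class.

If `δ` is off the line of `ψ`, one disintegrates along `V = δᵀ X`.  On a fibre, `X*` weighted by the
conditional density of `U = ψᵀ X` gives a function `h v u` that is continuous in `u`, and moving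
the half-space changes the integral of `h v` over `(-∞, c]` into the one over
`(-∞, c + τ (s - v)]`.  The hypotheses dominate only `v * h v u`, and only from above.  Comparing
the versions for `δ` and `-δ` makes the bound two-sided, and `v² f = v E(V | ·) f` gives it for the
last coordinate (`Regular.exists_isFiberDensity`).  Since `s * h v u` need not be dominated near
`v = 0`, the half-space is first translated to the level `c + τ s`, which involves only the law of
`U` and its continuous weighted densities, and then tilted, which costs the factor `v`
(`IsFiberDensity.hasDerivAt_setIntegral`).  If `δ` is a multiple of `ψ`, the half-space is only
rescaled and translated.

Integrating `v * h v u` over the fibres also yields a continuous density of the law of `U` weighted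
by `δᵀ X X*`.  In dimension at least two every coordinate vector is a difference of two vectors off
the line of `ψ`, so all second moments `X* X*ᵀ` have such densities; they vanish where the density
`f` of `U` does, so dividing by `f` gives the required versions (`exists_isContVersion`).
Continuous weighted densities are unique, so every other choice of versions gives the same
products.  For the joint differentiability, the mean value inequality along segments upgrades
directional derivatives that depend continuously on the point
(`hasFDerivAt_of_hasLineDerivAt`).
-/

namespace PSVM

/-! ### Densities of weighted laws -/

section Weighted

variable {Ω β : Type*} [MeasurableSpace Ω] [MeasurableSpace β]

/-- The image under `G` of the signed measure `W μ` has the density `g` with respect to `ν`.  If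
`G` itself has the density `d`, then `g = d * E(W | G = ·)`; the point of the notion is that the
product may be continuous although `E(W | G = ·)` is arbitrary where `d` vanishes. -/
def IsWeightedDensity (μ : Measure Ω) (G : Ω → β) (W : Ω → ℝ) (ν : Measure β) (g : β → ℝ) : Prop :=
  Integrable g ν ∧ ∀ B, MeasurableSet B → ∫ ω in G ⁻¹' B, W ω ∂μ = ∫ b in B, g b ∂ν

namespace IsWeightedDensity

variable {μ : Measure Ω} {G : Ω → β} {W W' : Ω → ℝ} {ν : Measure β} {g g' : β → ℝ}

lemma sub (hW : Integrable W μ) (hW' : Integrable W' μ) (h : IsWeightedDensity μ G W ν g)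
    (h' : IsWeightedDensity μ G W' ν g') :
    IsWeightedDensity μ G (fun ω => W ω - W' ω) ν (fun b => g b - g' b) := by
  refine ⟨h.1.sub h'.1, fun B hB => ?_⟩
  rw [integral_sub hW.integrableOn hW'.integrableOn,
    integral_sub h.1.integrableOn h'.1.integrableOn, h.2 B hB, h'.2 B hB]

lemma const_mul (c : ℝ) (h : IsWeightedDensity μ G W ν g) :
    IsWeightedDensity μ G (fun ω => c * W ω) ν (fun b => c * g b) := by
  refine ⟨h.1.const_mul c, fun B hB => ?_⟩
  rw [integral_const_mul, integral_const_mul, h.2 B hB]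

lemma sum {ι : Type*} (s : Finset ι) {W : ι → Ω → ℝ} {g : ι → β → ℝ}
    (hW : ∀ i ∈ s, Integrable (W i) μ) (h : ∀ i ∈ s, IsWeightedDensity μ G (W i) ν (g i)) :
    IsWeightedDensity μ G (fun ω => ∑ i ∈ s, W i ω) ν (fun b => ∑ i ∈ s, g i b) := by
  refine ⟨integrable_finsetSum s fun i hi => (h i hi).1, fun B hB => ?_⟩
  rw [integral_finsetSum s fun i hi => (hW i hi).integrableOn,
    integral_finsetSum s fun i hi => (h i hi).1.integrableOn]
  exact Finset.sum_congr rfl fun i hi => (h i hi).2 B hB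

lemma ae_eq (h : IsWeightedDensity μ G W ν g) (h' : IsWeightedDensity μ G W ν g') :
    g =ᵐ[ν] g' :=
  Integrable.ae_eq_of_forall_setIntegral_eq g g' h.1 h'.1
    fun B hB _ => (h.2 B hB).symm.trans (h'.2 B hB)

lemma eq_of_continuous {G : Ω → ℝ} {g g' : ℝ → ℝ} (h : IsWeightedDensity μ G W volume g)
    (h' : IsWeightedDensity μ G W volume g') (hg : Continuous g) (hg' : Continuous g') : g = g' :=
  (Continuous.ae_eq_iff_eq volume hg hg').1 (h.ae_eq h')

/-- A version of a joint density that is continuous in its second argument is determined on almost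
every fibre. -/
lemma ae_forall_eq {V U : Ω → ℝ} {ρ : Measure ℝ} {g g' : ℝ → ℝ → ℝ}
    (h : IsWeightedDensity μ (fun ω => (V ω, U ω)) W (ρ.prod volume) fun z => g z.1 z.2)
    (h' : IsWeightedDensity μ (fun ω => (V ω, U ω)) W (ρ.prod volume) fun z => g' z.1 z.2)
    (hg : ∀ v, Continuous (g v)) (hg' : ∀ v, Continuous (g' v)) : ∀ᵐ v ∂ρ, g v = g' v := by
  filter_upwards [Measure.ae_ae_of_ae_prod (h.ae_eq h')] with v hv
  exact (Continuous.ae_eq_iff_eq volume (hg v) (hg' v)).1 hv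

/-- Integrating out the first coordinate. -/
lemma marginal {V U : Ω → ℝ} {ρ : Measure ℝ} [SFinite ρ] {g : ℝ → ℝ → ℝ}
    (h : IsWeightedDensity μ (fun ω => (V ω, U ω)) W (ρ.prod volume) fun z => g z.1 z.2) :
    IsWeightedDensity μ U W volume fun u => ∫ v, g v u ∂ρ := by
  refine ⟨h.1.integral_prod_right, fun B hB => ?_⟩
  have h1 := h.2 (Set.univ ×ˢ B) (MeasurableSet.univ.prod hB)
  have h2 : (fun ω => (V ω, U ω)) ⁻¹' (Set.univ ×ˢ B) = U ⁻¹' B := by ext; simp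
  rw [h2] at h1
  rw [h1, ← Measure.prod_restrict, Measure.restrict_univ, integral_prod_symm]
  have := h.1.integrableOn (s := Set.univ ×ˢ B)
  rwa [IntegrableOn, ← Measure.prod_restrict, Measure.restrict_univ] at this

/-- If `G` has the density `d` and `r = E(W | G = ·)`, then `φ(G) W` has the weighted density
`φ r d`. -/
lemma of_isCondMean [IsFiniteMeasure μ] {d r φ : β → ℝ} (hG : Measurable G)
    (hd : Measurable d) (hd0 : ∀ b, 0 ≤ d b)
    (hlaw : μ.map G = ν.withDensity fun b => ENNReal.ofReal (d b))
    (hr : IsCondMean μ W G r) (hφ : Measurable φ) (hW : Integrable W μ)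
    (hφW : Integrable (fun ω => φ (G ω) * W ω) μ) :
    IsWeightedDensity μ G (fun ω => φ (G ω) * W ω) ν fun b => φ b * (r b * d b) := by
  have hm : MeasurableSpace.comap G inferInstance ≤ (inferInstance : MeasurableSpace Ω) :=
    hG.comap_le
  have hφG : StronglyMeasurable[MeasurableSpace.comap G inferInstance] fun ω => φ (G ω) :=
    (hφ.comp (comap_measurable G)).stronglyMeasurable
  have hpull : (fun ω => φ (G ω) * r (G ω)) =ᵐ[μ]
      μ[fun ω => φ (G ω) * W ω | MeasurableSpace.comap G inferInstance] := by
    have h1 := condExp_mul_of_stronglyMeasurable_left (μ := μ) (g := W) hφG hφW hW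
    filter_upwards [h1, hr.2] with ω h1 h2
    rw [h2]; exact h1.symm
  have hmeas : Measurable fun b => φ b * r b := hφ.mul hr.1
  have hint : Integrable (fun ω => φ (G ω) * r (G ω)) μ := integrable_condExp.congr hpull.symm
  have hofReal : Measurable fun b => ENNReal.ofReal (d b) := hd.ennreal_ofReal
  have hsmul : (fun b => (ENNReal.ofReal (d b)).toReal • (φ b * r b)) =
      fun b => φ b * (r b * d b) := by
    funext b
    rw [ENNReal.toReal_ofReal (hd0 b), smul_eq_mul]; ring
  constructor
  · have h1 : Integrable (fun b => φ b * r b) (μ.map G) :=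
      (integrable_map_measure hmeas.aestronglyMeasurable hG.aemeasurable).2 hint
    rw [hlaw, integrable_withDensity_iff_integrable_smul' hofReal
      (Filter.Eventually.of_forall fun _ => ENNReal.ofReal_lt_top), hsmul] at h1
    exact h1
  · intro B hB
    have h1 := setIntegral_map (μ := μ) (g := G) hB hmeas.aestronglyMeasurable hG.aemeasurable
    rw [hlaw, setIntegral_withDensity_eq_setIntegral_toReal_smul hofReal
      (Filter.Eventually.of_forall fun _ => ENNReal.ofReal_lt_top) _ hB, hsmul] at h1
    rw [h1, ← setIntegral_condExp hm hφW ⟨B, hB, rfl⟩]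
    refine integral_congr_ae (ae_restrict_of_ae ?_)
    exact hpull.symm

end IsWeightedDensity

lemma isCondMean_const (μ : Measure Ω) [IsFiniteMeasure μ] (c : ℝ) {G : Ω → β}
    (hG : Measurable G) : IsCondMean μ (fun _ => c) G (fun _ => c) :=
  ⟨measurable_const, by rw [condExp_const hG.comap_le]⟩

/-- Conditioning on `G` and on an isomorphic image of `G` is the same. -/
lemma IsCondMean.comp_equiv {γ : Type*} [MeasurableSpace γ] {μ : Measure Ω} {W : Ω → ℝ}
    {G : Ω → β} {r : β → ℝ} (h : IsCondMean μ W G r) (e : γ ≃ᵐ β) {G' : Ω → γ}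
    (hG : ∀ ω, e (G' ω) = G ω) : IsCondMean μ W G' (fun c => r (e c)) := by
  have hG' : G = e ∘ G' := funext fun ω => (hG ω).symm
  refine ⟨h.1.comp e.measurable, ?_⟩
  have h2 := h.2
  subst hG'
  rwa [← MeasurableSpace.comap_comp, e.measurableEmbedding.comap_eq] at h2

/-- A weighted density that vanishes with the density of `G` gives a conditional mean. -/
lemma IsWeightedDensity.isCondMean_div {μ : Measure Ω} [IsFiniteMeasure μ] {G : Ω → β}
    {W : Ω → ℝ} {ν : Measure β} {g d : β → ℝ} (h : IsWeightedDensity μ G W ν g)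
    (hW : Integrable W μ) (hG : Measurable G) (hg : Measurable g)
    (hd : Measurable d) (hd0 : ∀ b, 0 ≤ d b)
    (hlaw : μ.map G = ν.withDensity fun b => ENNReal.ofReal (d b))
    (hzero : ∀ b, d b = 0 → g b = 0) : IsCondMean μ W G fun b => g b / d b := by
  have hmeas : Measurable fun b => g b / d b := hg.div hd
  have hofReal : Measurable fun b => ENNReal.ofReal (d b) := hd.ennreal_ofReal
  have hsmul : (fun b => (ENNReal.ofReal (d b)).toReal • (g b / d b)) = g := by
    funext b
    rw [ENNReal.toReal_ofReal (hd0 b), smul_eq_mul]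
    by_cases hb : d b = 0
    · rw [hb, hzero b hb]; simp
    · field_simp
  have hint : Integrable (fun ω => g (G ω) / d (G ω)) μ := by
    have h1 : Integrable (fun b => g b / d b) (μ.map G) := by
      rw [hlaw, integrable_withDensity_iff_integrable_smul' hofReal
        (Filter.Eventually.of_forall fun _ => ENNReal.ofReal_lt_top), hsmul]
      exact h.1
    exact h1.comp_measurable hG
  refine ⟨hmeas, ae_eq_condExp_of_forall_setIntegral_eq hG.comap_le hW
    (fun _ _ _ => hint.integrableOn) ?_ ?_⟩
  · rintro _ ⟨B, hB, rfl⟩ -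
    have h1 := setIntegral_map (μ := μ) (g := G) hB hmeas.aestronglyMeasurable hG.aemeasurable
    rw [hlaw, setIntegral_withDensity_eq_setIntegral_toReal_smul hofReal
      (Filter.Eventually.of_forall fun _ => ENNReal.ofReal_lt_top) _ hB, hsmul] at h1
    rw [h.2 B hB, h1]
  · exact (hmeas.comp (comap_measurable G)).stronglyMeasurable.aestronglyMeasurable

end Weighted

/-! ### Fibre densities of the augmented vector -/

section Fiber

variable {Ω : Type*} [MeasurableSpace Ω] {p : ℕ}

lemma measurable_lin {X : Ω → EuclideanSpace ℝ (Fin p)} (hX : Measurable X)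
    (ψ : EuclideanSpace ℝ (Fin p)) : Measurable fun ω => lin ψ (X ω) := by
  unfold lin; fun_prop

lemma measurable_star {X : Ω → EuclideanSpace ℝ (Fin p)} (hX : Measurable X)
    (k : Fin p ⊕ Unit) : Measurable fun ω => star (X ω) k := by
  cases k <;> simp only [star, Sum.elim_inl, Sum.elim_inr] <;> fun_prop

lemma memLp_coord {μ : Measure Ω} {X : Ω → EuclideanSpace ℝ (Fin p)} (hX2 : MemLp X 2 μ)
    (i : Fin p) : MemLp (fun ω => X ω i) 2 μ :=
  (EuclideanSpace.proj (𝕜 := ℝ) i).comp_memLp' hX2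

lemma memLp_lin {μ : Measure Ω} {X : Ω → EuclideanSpace ℝ (Fin p)} (hX2 : MemLp X 2 μ)
    (ψ : EuclideanSpace ℝ (Fin p)) : MemLp (fun ω => lin ψ (X ω)) 2 μ :=
  memLp_finsetSum _ fun i _ => (memLp_coord hX2 i).const_mul (ψ i)

variable {μ : Measure Ω} [IsFiniteMeasure μ] {X : Ω → EuclideanSpace ℝ (Fin p)}

lemma memLp_star (hX2 : MemLp X 2 μ) (k : Fin p ⊕ Unit) : MemLp (fun ω => star (X ω) k) 2 μ := by
  cases k with
  | inl i => exact memLp_coord hX2 i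
  | inr _ => exact memLp_const (-1)

lemma integrable_star (hX2 : MemLp X 2 μ) (k : Fin p ⊕ Unit) :
    Integrable (fun ω => star (X ω) k) μ :=
  (memLp_star hX2 k).integrable (by norm_num)

lemma integrable_lin_mul_star (hX2 : MemLp X 2 μ) (δ : EuclideanSpace ℝ (Fin p))
    (k : Fin p ⊕ Unit) : Integrable (fun ω => lin δ (X ω) * star (X ω) k) μ :=
  (memLp_lin hX2 δ).integrable_mul (memLp_star hX2 k)

lemma integrable_star_mul_star (hX2 : MemLp X 2 μ) (k l : Fin p ⊕ Unit) :
    Integrable (fun ω => star (X ω) k * star (X ω) l) μ :=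
  (memLp_star hX2 k).integrable_mul (memLp_star hX2 l)

lemma lin_neg (δ x : EuclideanSpace ℝ (Fin p)) : lin (-δ) x = -lin δ x := by
  simp [lin]

lemma lin_add (δ δ' x : EuclideanSpace ℝ (Fin p)) : lin (δ + δ') x = lin δ x + lin δ' x := by
  simp [lin, add_mul, Finset.sum_add_distrib]

lemma lin_smul (a : ℝ) (δ x : EuclideanSpace ℝ (Fin p)) : lin (a • δ) x = a * lin δ x := by
  simp [lin, Finset.mul_sum, mul_assoc]

lemma lin_eq_sum_star (δ x : EuclideanSpace ℝ (Fin p)) :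
    lin δ x = ∑ i, δ i * star x (Sum.inl i) := rfl

/-- `h k v u` is a version of `f_{U|V}(u | v) E(X*_k | U = u, V = v)`, where `U = ψᵀ X` and
`V = δᵀ X`, that is continuous in `u`, and such that `v * h k v u` is bounded in `u` by an
integrable function of `v`.  Such a bound is available only with the factor `v`, except for the
last coordinate, where `-h` is the conditional density. -/
structure IsFiberDensity (μ : Measure Ω) (X : Ω → EuclideanSpace ℝ (Fin p))
    (ψ δ : EuclideanSpace ℝ (Fin p)) (h : Fin p ⊕ Unit → ℝ → ℝ → ℝ) : Prop where
  measurable : ∀ k, Measurable fun z : ℝ × ℝ => h k z.1 z.2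
  continuous : ∀ k v, Continuous (h k v)
  density : ∀ k, IsWeightedDensity μ (fun ω => (lin δ (X ω), lin ψ (X ω))) (fun ω => star (X ω) k)
    ((μ.map fun ω => lin δ (X ω)).prod volume) fun z => h k z.1 z.2
  density_mul : ∀ k, IsWeightedDensity μ (fun ω => (lin δ (X ω), lin ψ (X ω)))
    (fun ω => lin δ (X ω) * star (X ω) k)
    ((μ.map fun ω => lin δ (X ω)).prod volume) fun z => z.1 * h k z.1 z.2
  nonpos : ∀ v u, h (Sum.inr ()) v u ≤ 0
  eq_zero : ∀ k v u, h (Sum.inr ()) v u = 0 → h k v u = 0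
  bound : ∃ c : ℝ → ℝ, Integrable c (μ.map fun ω => lin δ (X ω)) ∧
    ∀ v u, |h (Sum.inr ()) v u| ≤ c v
  bound_mul : ∀ k, ∃ c : ℝ → ℝ, Integrable c (μ.map fun ω => lin δ (X ω)) ∧
    ∀ᵐ v ∂(μ.map fun ω => lin δ (X ω)), ∀ u, |v * h k v u| ≤ c v

/-- The part of the regularity conditions that concerns a single pair `(ψ, δ)`: the bounds on
`v * h k v u` are only one-sided. -/
lemma Regular.exists_oneSided (hX : Measurable X) (hX2 : MemLp X 2 μ)
    {ψ δ : EuclideanSpace ℝ (Fin p)} (hreg : Regular μ X ψ δ) :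
    ∃ h : Fin p ⊕ Unit → ℝ → ℝ → ℝ,
      (∀ k, Measurable fun z : ℝ × ℝ => h k z.1 z.2) ∧ (∀ k v, Continuous (h k v)) ∧
      (∀ φ : ℝ × ℝ → ℝ, Measurable φ → ∀ k,
        Integrable (fun ω => φ (lin δ (X ω), lin ψ (X ω)) * star (X ω) k) μ →
        IsWeightedDensity μ (fun ω => (lin δ (X ω), lin ψ (X ω)))
          (fun ω => φ (lin δ (X ω), lin ψ (X ω)) * star (X ω) k)
          ((μ.map fun ω => lin δ (X ω)).prod volume) fun z => φ z * h k z.1 z.2) ∧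
      (∀ v u, h (Sum.inr ()) v u ≤ 0) ∧ (∀ k v u, h (Sum.inr ()) v u = 0 → h k v u = 0) ∧
      (∃ c : ℝ → ℝ, Integrable c (μ.map fun ω => lin δ (X ω)) ∧
        ∀ v u, |h (Sum.inr ()) v u| ≤ c v) ∧
      ∀ i, ∃ c : ℝ → ℝ, (∀ v, 0 ≤ c v) ∧ Integrable c (μ.map fun ω => lin δ (X ω)) ∧
        ∀ v u, v * h (Sum.inl i) v u ≤ c v := by
  obtain ⟨f, r, ⟨hfm, hf0, hflaw⟩, hr, hcont, hc, c₀, -, hc₀, hfc₀⟩ := hreg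
  have hfm' : Measurable fun z : ℝ × ℝ => f z.2 z.1 := hfm.comp measurable_swap
  have hG : Measurable fun ω => (lin δ (X ω), lin ψ (X ω)) :=
    (measurable_lin hX δ).prodMk (measurable_lin hX ψ)
  have hmean : ∀ k, IsCondMean μ (fun ω => star (X ω) k)
      (fun ω => (lin δ (X ω), lin ψ (X ω))) fun z => star (r z.2 z.1) k := by
    rintro (i | _)
    · exact (hr i).comp_equiv MeasurableEquiv.prodComm (fun _ => rfl)
    · exact isCondMean_const μ (-1) hG
  refine ⟨fun k v u => f u v * star (r u v) k, fun k => hfm'.mul (hmean k).1, fun k v => ?_,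
    fun φ hφ k hi => ?_, fun v u => ?_, fun k v u h => ?_, ⟨c₀, hc₀, fun v u => ?_⟩, fun i => ?_⟩
  · exact (continuous_apply k).comp (hcont v)
  · have := IsWeightedDensity.of_isCondMean (ν := (μ.map fun ω => lin δ (X ω)).prod volume)
      hG hfm' (fun z => hf0 z.2 z.1) hflaw (hmean k) hφ (integrable_star hX2 k) hi
    simpa only [mul_comm (star _ k) (f _ _)] using this
  · simpa [star] using hf0 u v
  · have h0 : f u v = 0 := by simpa [star] using h
    simp [h0]
  · have : |f u v| = f u v := abs_of_nonneg (hf0 u v)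
    simpa [star, this] using hfc₀ u v
  · obtain ⟨c, hc0, hci, hcb⟩ := hc i
    refine ⟨c, hc0, hci, fun v u => le_trans (le_of_eq ?_) (hcb u v)⟩
    simp only [star, Sum.elim_inl]; ring

/-- The regularity conditions at `(ψ, δ)` and at `(ψ, -δ)` together give two-sided bounds: the two
fibre densities are reflections of each other on almost every fibre.  For the last coordinate the
bound comes from `v² f = v E(δᵀ X | ·) f`. -/
lemma Regular.exists_isFiberDensity (hX : Measurable X) (hX2 : MemLp X 2 μ)
    {ψ δ : EuclideanSpace ℝ (Fin p)} (hreg : Regular μ X ψ δ) (hreg' : Regular μ X ψ (-δ)) :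
    ∃ h, IsFiberDensity μ X ψ δ h := by
  obtain ⟨h, hm, hcont, hdens, hneg, hzero, ⟨c₀, hc₀, hhc₀⟩, hc⟩ := hreg.exists_oneSided hX hX2
  obtain ⟨h', hm', hcont', hdens', -, -, -, hc'⟩ := hreg'.exists_oneSided hX hX2
  have hV : Measurable fun ω => lin δ (X ω) := measurable_lin hX δ
  have hd : ∀ k, IsWeightedDensity μ (fun ω => (lin δ (X ω), lin ψ (X ω)))
      (fun ω => star (X ω) k)
      ((μ.map fun ω => lin δ (X ω)).prod volume) fun z => h k z.1 z.2 := fun k => by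
    simpa using hdens (fun _ => 1) measurable_const k (by simpa using integrable_star hX2 k)
  have hd' : ∀ k, IsWeightedDensity μ (fun ω => (lin (-δ) (X ω), lin ψ (X ω)))
      (fun ω => star (X ω) k)
      ((μ.map fun ω => lin (-δ) (X ω)).prod volume) fun z => h' k z.1 z.2 := fun k => by
    simpa using hdens' (fun _ => 1) measurable_const k (by simpa using integrable_star hX2 k)
  have hmap : (μ.map fun ω => lin (-δ) (X ω)) = (μ.map fun ω => lin δ (X ω)).map Neg.neg := by
    rw [Measure.map_map measurable_neg hV]
    simp only [lin_neg]; rfl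
  have hreflect : ∀ k, ∀ᵐ v ∂(μ.map fun ω => lin δ (X ω)), h k v = h' k (-v) := fun k => by
    refine IsWeightedDensity.ae_forall_eq (hd k) ?_ (hcont k) fun v => hcont' k (-v)
    have hmp : MeasurePreserving (Prod.map (Neg.neg : ℝ → ℝ) (id : ℝ → ℝ))
        ((μ.map fun ω => lin δ (X ω)).prod volume)
        ((μ.map fun ω => lin (-δ) (X ω)).prod volume) :=
      MeasurePreserving.prod ⟨measurable_neg, hmap.symm⟩ (MeasurePreserving.id _)
    have hemb : MeasurableEmbedding (Prod.map (Neg.neg : ℝ → ℝ) (id : ℝ → ℝ)) :=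
      ((MeasurableEquiv.neg ℝ).prodCongr (MeasurableEquiv.refl ℝ)).measurableEmbedding
    constructor
    · exact hmp.integrable_comp_of_integrable (hd' k).1
    · intro B hB
      have h1 := (hd' k).2 (Prod.map (Neg.neg : ℝ → ℝ) (id : ℝ → ℝ) ⁻¹' B)
        (hmp.measurable hB)
      rw [← hmp.setIntegral_preimage_emb hemb] at h1
      have h2 : ∀ A : Set (ℝ × ℝ), (fun ω => (lin (-δ) (X ω), lin ψ (X ω))) ⁻¹'
          (Prod.map (Neg.neg : ℝ → ℝ) (id : ℝ → ℝ) ⁻¹' A) =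
          (fun ω => (lin δ (X ω), lin ψ (X ω))) ⁻¹' A := fun A => by
        ext ω; simp [lin_neg]
      have h3 : Prod.map (Neg.neg : ℝ → ℝ) (id : ℝ → ℝ) ⁻¹'
          (Prod.map (Neg.neg : ℝ → ℝ) (id : ℝ → ℝ) ⁻¹' B) = B := by
        ext ⟨a, b⟩; simp
      rw [h2, h3] at h1
      exact h1
  have hbound : ∀ i : Fin p, ∃ c : ℝ → ℝ, Integrable c (μ.map fun ω => lin δ (X ω)) ∧
      ∀ᵐ v ∂(μ.map fun ω => lin δ (X ω)), ∀ u, |v * h (Sum.inl i) v u| ≤ c v := fun i => by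
    obtain ⟨c, hc0, hci, hcb⟩ := hc i
    obtain ⟨c', hc0', hci', hcb'⟩ := hc' i
    refine ⟨fun v => c v + c' (-v), hci.add ?_, ?_⟩
    · rw [hmap] at hci'
      exact (MeasurableEquiv.neg ℝ).measurableEmbedding.integrable_map_iff.1 hci'
    · filter_upwards [hreflect (Sum.inl i)] with v hv u
      have h1 := hcb v u
      have h2 := hcb' (-v) u
      rw [← hv] at h2
      have h3 := hc0 v
      have h4 := hc0' (-v)
      rw [abs_le]
      constructor <;> linarith
  have hVf : ∀ᵐ v ∂(μ.map fun ω => lin δ (X ω)),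
      (fun u => v * h (Sum.inr ()) v u) = fun u => -∑ i, δ i * h (Sum.inl i) v u := by
    refine IsWeightedDensity.ae_forall_eq (hdens Prod.fst measurable_fst (Sum.inr ())
      (integrable_lin_mul_star hX2 δ _)) ?_ (fun v => continuous_const.mul (hcont _ v))
      fun v => (continuous_finsetSum _ fun i _ => continuous_const.mul (hcont _ v)).neg
    have h1 := (IsWeightedDensity.sum Finset.univ
      (fun i _ => (integrable_star hX2 (Sum.inl i)).const_mul (δ i))
      (fun i _ => (hd (Sum.inl i)).const_mul (δ i))).const_mul (-1)
    simpa [star, lin] using h1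
  refine ⟨h, hm, hcont, hd, fun k => hdens Prod.fst measurable_fst k
    (integrable_lin_mul_star hX2 δ k), hneg, hzero, ⟨c₀, hc₀, hhc₀⟩, ?_⟩
  rintro (i | ⟨⟩)
  · exact hbound i
  · choose c hci hcb using hbound
    refine ⟨fun v => c₀ v + ∑ i, |δ i| * c i v,
      hc₀.add (integrable_finsetSum _ fun i _ => (hci i).const_mul _), ?_⟩
    filter_upwards [hVf, ae_all_iff.2 hcb] with v hv hb u
    -- `|v| ≤ 1 + v²` reduces the claim to a bound on `v² f`
    have h1 : |v * (v * h (Sum.inr ()) v u)| ≤ ∑ i, |δ i| * c i v := by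
      rw [congrFun hv u, mul_neg, abs_neg, Finset.mul_sum]
      refine (Finset.abs_sum_le_sum_abs _ _).trans (Finset.sum_le_sum fun i _ => ?_)
      calc |v * (δ i * h (Sum.inl i) v u)| = |δ i| * |v * h (Sum.inl i) v u| := by
            rw [← abs_mul]; ring_nf
        _ ≤ |δ i| * c i v := mul_le_mul_of_nonneg_left (hb i u) (abs_nonneg _)
    have h2 := hhc₀ v u
    have h3 : |v| ≤ 1 + |v * v| := by
      rw [abs_mul]; nlinarith [sq_nonneg (|v| - 1), abs_nonneg v]
    calc |v * h (Sum.inr ()) v u| = |v| * |h (Sum.inr ()) v u| := abs_mul _ _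
      _ ≤ (1 + |v * v|) * |h (Sum.inr ()) v u| :=
          mul_le_mul_of_nonneg_right h3 (abs_nonneg _)
      _ = |h (Sum.inr ()) v u| + |v * (v * h (Sum.inr ()) v u)| := by
          rw [← mul_assoc, abs_mul (v * v)]; ring
      _ ≤ _ := add_le_add h2 h1

end Fiber

/-! ### Continuous versions of the density and of the weighted second moments -/

lemma exists_linearIndependent_pair {p : ℕ} (hp : 2 ≤ p) {ψ : EuclideanSpace ℝ (Fin p)}
    (hψ : ψ ≠ 0) : ∃ δ, LinearIndependent ℝ ![ψ, δ] :=
  exists_linearIndependent_pair_of_one_lt_finrank (by rw [finrank_euclideanSpace_fin]; omega) hψ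

/-- In dimension at least two every vector is a difference of two vectors off the line of `ψ`. -/
lemma exists_eq_sub_linearIndependent {p : ℕ} (hp : 2 ≤ p) {ψ : EuclideanSpace ℝ (Fin p)}
    (hψ : ψ ≠ 0) (e : EuclideanSpace ℝ (Fin p)) :
    ∃ δ δ', LinearIndependent ℝ ![ψ, δ] ∧ LinearIndependent ℝ ![ψ, δ'] ∧ e = δ - δ' := by
  by_cases he : LinearIndependent ℝ ![ψ, e]
  · refine ⟨(2 : ℝ) • e, e, ?_, he, by rw [two_smul, add_sub_cancel_right]⟩
    rw [LinearIndependent.pair_iff' hψ] at he ⊢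
    intro a ha
    exact he (a / 2) (by rw [div_eq_inv_mul, mul_smul, ha, smul_smul]; norm_num)
  · obtain ⟨δ, hδ⟩ := exists_linearIndependent_pair hp hψ
    rw [LinearIndependent.pair_iff' hψ] at he
    push Not at he
    obtain ⟨a, rfl⟩ := he
    refine ⟨δ + a • ψ, δ, ?_, hδ, by rw [add_sub_cancel_left]⟩
    rw [LinearIndependent.pair_iff' hψ] at hδ ⊢
    intro b hb
    exact hδ (b - a) (by rw [sub_smul, hb, add_sub_cancel_right])

section Versions

variable {Ω : Type*} [MeasurableSpace Ω] {p : ℕ} {μ : Measure Ω}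
  {X : Ω → EuclideanSpace ℝ (Fin p)}

namespace IsFiberDensity

variable {ψ δ : EuclideanSpace ℝ (Fin p)} {h : Fin p ⊕ Unit → ℝ → ℝ → ℝ}

lemma measurable_left (hh : IsFiberDensity μ X ψ δ h) (k : Fin p ⊕ Unit) (u : ℝ) :
    Measurable fun v => h k v u :=
  (hh.measurable k).comp (measurable_id.prodMk measurable_const)

lemma continuous_integral_mul (hh : IsFiberDensity μ X ψ δ h) (k : Fin p ⊕ Unit) :
    Continuous fun u => ∫ v, v * h k v u ∂(μ.map fun ω => lin δ (X ω)) := by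
  obtain ⟨c, hci, hcb⟩ := hh.bound_mul k
  refine continuous_of_dominated
    (fun u => (measurable_id.mul (hh.measurable_left k u)).aestronglyMeasurable)
    (fun u => ?_) hci (Filter.Eventually.of_forall fun v =>
      continuous_const.mul (hh.continuous k v))
  filter_upwards [hcb] with v hv using hv u

lemma continuous_integral (hh : IsFiberDensity μ X ψ δ h) :
    Continuous fun u => ∫ v, h (Sum.inr ()) v u ∂(μ.map fun ω => lin δ (X ω)) := by
  obtain ⟨c, hci, hcb⟩ := hh.bound
  exact continuous_of_dominated (fun u => (hh.measurable_left _ u).aestronglyMeasurable)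
    (fun u => Filter.Eventually.of_forall fun v => hcb v u) hci
    (Filter.Eventually.of_forall fun v => hh.continuous _ v)

/-- Where the density of `ψᵀ X` vanishes, almost every conditional density vanishes, and with it
the fibre densities of the other coordinates. -/
lemma integral_mul_eq_zero (hh : IsFiberDensity μ X ψ δ h) (k : Fin p ⊕ Unit) {u : ℝ}
    (hu : ∫ v, h (Sum.inr ()) v u ∂(μ.map fun ω => lin δ (X ω)) = 0) :
    ∫ v, v * h k v u ∂(μ.map fun ω => lin δ (X ω)) = 0 := by
  obtain ⟨c, hci, hcb⟩ := hh.bound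
  have hint : Integrable (fun v => h (Sum.inr ()) v u) (μ.map fun ω => lin δ (X ω)) :=
    hci.mono' (hh.measurable_left _ u).aestronglyMeasurable
      (Filter.Eventually.of_forall fun v => hcb v u)
  have h0 : ∫ v, -h (Sum.inr ()) v u ∂(μ.map fun ω => lin δ (X ω)) = 0 := by
    rw [integral_neg, hu, neg_zero]
  rw [integral_eq_zero_iff_of_nonneg (fun v => neg_nonneg.2 (hh.nonpos v u)) hint.neg] at h0
  refine integral_eq_zero_of_ae ?_
  filter_upwards [h0] with v hv
  have : h (Sum.inr ()) v u = 0 := neg_eq_zero.1 hv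
  simp [hh.eq_zero k v u this]

end IsFiberDensity

lemma IsContVersion.continuous_entry {ψ : EuclideanSpace ℝ (Fin p)} {f : ℝ → ℝ}
    {M : ℝ → Matrix (Fin p ⊕ Unit) (Fin p ⊕ Unit) ℝ} (hv : IsContVersion μ X ψ f M)
    (k l : Fin p ⊕ Unit) :
    Continuous fun u => f u * M u k l :=
  hv.2.2.2.matrix_elem k l

variable [IsFiniteMeasure μ]

/-- The law of `ψᵀ X` and all its `X*_k X*_l`-weighted versions have continuous densities, and the
weighted ones vanish wherever the density itself does. -/
lemma exists_continuous_densities (hp : 2 ≤ p) (hX2 : MemLp X 2 μ)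
    {ψ : EuclideanSpace ℝ (Fin p)} (hψ : ψ ≠ 0)
    (hreg : ∀ δ, LinearIndependent ℝ ![ψ, δ] → ∃ h, IsFiberDensity μ X ψ δ h) :
    ∃ (F : ℝ → ℝ) (g : Fin p ⊕ Unit → Fin p ⊕ Unit → ℝ → ℝ),
      Continuous F ∧ (∀ u, 0 ≤ F u) ∧
      IsWeightedDensity μ (fun ω => lin ψ (X ω)) (fun _ => 1) volume F ∧
      ∀ k l, Continuous (g k l) ∧ (∀ u, F u = 0 → g k l u = 0) ∧
        IsWeightedDensity μ (fun ω => lin ψ (X ω)) (fun ω => star (X ω) k * star (X ω) l)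
          volume (g k l) := by
  have hF : ∀ δ h, IsFiberDensity μ X ψ δ h →
      IsWeightedDensity μ (fun ω => lin ψ (X ω)) (fun _ => 1) volume
        fun u => -1 * ∫ v, h (Sum.inr ()) v u ∂(μ.map fun ω => lin δ (X ω)) := fun δ h hh => by
    have := (hh.density (Sum.inr ())).marginal.const_mul (-1)
    simpa only [star, Sum.elim_inr, mul_neg, neg_mul, one_mul, neg_neg] using this
  obtain ⟨δ₀, hδ₀⟩ := exists_linearIndependent_pair hp hψ
  obtain ⟨h₀, hh₀⟩ := hreg δ₀ hδ₀
  set F : ℝ → ℝ := fun u => -1 * ∫ v, h₀ (Sum.inr ()) v u ∂(μ.map fun ω => lin δ₀ (X ω)) with hFdef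
  have hFc : Continuous F := continuous_const.mul hh₀.continuous_integral
  have hlin : ∀ (e : EuclideanSpace ℝ (Fin p)) (k : Fin p ⊕ Unit), ∃ g : ℝ → ℝ, Continuous g ∧
      (∀ u, F u = 0 → g u = 0) ∧ IsWeightedDensity μ (fun ω => lin ψ (X ω))
        (fun ω => lin e (X ω) * star (X ω) k) volume g := by
    have hLI : ∀ (e : EuclideanSpace ℝ (Fin p)) (k : Fin p ⊕ Unit),
        LinearIndependent ℝ ![ψ, e] → ∃ g : ℝ → ℝ, Continuous g ∧
        (∀ u, F u = 0 → g u = 0) ∧ IsWeightedDensity μ (fun ω => lin ψ (X ω))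
          (fun ω => lin e (X ω) * star (X ω) k) volume g := fun e k he => by
      obtain ⟨h, hh⟩ := hreg e he
      refine ⟨_, hh.continuous_integral_mul k, fun u hu => hh.integral_mul_eq_zero k ?_,
        (hh.density_mul k).marginal⟩
      have := (hF δ₀ h₀ hh₀).eq_of_continuous (hF e h hh) hFc
        (continuous_const.mul hh.continuous_integral)
      have h1 := congrFun this u
      rw [hFdef] at hu
      simp only at hu h1
      linarith
    intro e k
    obtain ⟨δ, δ', hδ, hδ', rfl⟩ := exists_eq_sub_linearIndependent hp hψ e
    obtain ⟨g, hg, hg0, hgd⟩ := hLI δ k hδ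
    obtain ⟨g', hg', hg0', hgd'⟩ := hLI δ' k hδ'
    refine ⟨fun u => g u - g' u, hg.sub hg', fun u hu => by simp only [hg0 u hu, hg0' u hu, sub_zero], ?_⟩
    have := IsWeightedDensity.sub (integrable_lin_mul_star hX2 δ k)
      (integrable_lin_mul_star hX2 δ' k) hgd hgd'
    have hsub : ∀ x, lin (δ - δ') x = lin δ x - lin δ' x := fun x => by
      rw [sub_eq_add_neg, lin_add, lin_neg, ← sub_eq_add_neg]
    simpa only [hsub, sub_mul] using this
  have hcoord : ∀ (i : Fin p) (k : Fin p ⊕ Unit), ∃ g : ℝ → ℝ, Continuous g ∧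
      (∀ u, F u = 0 → g u = 0) ∧ IsWeightedDensity μ (fun ω => lin ψ (X ω))
        (fun ω => star (X ω) (Sum.inl i) * star (X ω) k) volume g := fun i k => by
    have := hlin (EuclideanSpace.single i 1) k
    simpa [lin, star, Pi.single_apply] using this
  have hall : ∀ k l : Fin p ⊕ Unit, ∃ g : ℝ → ℝ, Continuous g ∧
      (∀ u, F u = 0 → g u = 0) ∧ IsWeightedDensity μ (fun ω => lin ψ (X ω))
        (fun ω => star (X ω) k * star (X ω) l) volume g := by
    rintro (i | ⟨⟩) l
    · exact hcoord i l
    · rcases l with j | ⟨⟩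
      · simpa only [mul_comm] using hcoord j (Sum.inr ())
      · refine ⟨F, hFc, fun _ hu => hu, ?_⟩
        simpa only [star, Sum.elim_inr, mul_neg, mul_one, neg_neg] using hF δ₀ h₀ hh₀
  choose g hg using hall
  refine ⟨F, g, hFc, fun u => ?_, hF δ₀ h₀ hh₀, hg⟩
  have : ∫ v, h₀ (Sum.inr ()) v u ∂(μ.map fun ω => lin δ₀ (X ω)) ≤ 0 :=
    integral_nonpos fun v => hh₀.nonpos v u
  simp only [hFdef]
  linarith

lemma IsWeightedDensity.isDensity {U : Ω → ℝ} {F : ℝ → ℝ} (hU : Measurable U)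
    (h : IsWeightedDensity μ U (fun _ => 1) volume F) (hF : Measurable F) (hF0 : ∀ u, 0 ≤ F u) :
    IsDensity μ U F := by
  refine ⟨hF, hF0, Measure.ext fun B hB => ?_⟩
  have h1 := h.2 B hB
  rw [setIntegral_const, smul_eq_mul, mul_one] at h1
  rw [withDensity_apply _ hB, ← ofReal_integral_eq_lintegral_ofReal h.1.integrableOn
    (Filter.Eventually.of_forall hF0), ← h1, Measure.map_apply hU hB, ofReal_measureReal]

lemma exists_isContVersion (hp : 2 ≤ p) (hX : Measurable X) (hX2 : MemLp X 2 μ)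
    {ψ : EuclideanSpace ℝ (Fin p)} (hψ : ψ ≠ 0)
    (hreg : ∀ δ, LinearIndependent ℝ ![ψ, δ] → ∃ h, IsFiberDensity μ X ψ δ h) :
    ∃ f M, IsContVersion μ X ψ f M := by
  obtain ⟨F, g, hFc, hF0, hFd, hg⟩ := exists_continuous_densities hp hX2 hψ hreg
  have hU := measurable_lin hX ψ
  have hden := hFd.isDensity hU hFc.measurable hF0
  refine ⟨F, fun u => Matrix.of fun k l => g k l u / F u, hden, fun k l => ?_, hFc, ?_⟩
  · exact (hg k l).2.2.isCondMean_div (integrable_star_mul_star hX2 k l) hU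
      (hg k l).1.measurable hFc.measurable hF0 hden.2.2 (hg k l).2.1
  · refine continuous_matrix fun k l => ?_
    have : (fun u => (F u • (Matrix.of fun k l => g k l u / F u : Matrix _ _ ℝ)) k l) = g k l := by
      funext u
      rw [Matrix.smul_apply, Matrix.of_apply, smul_eq_mul]
      by_cases hu : F u = 0
      · rw [hu, (hg k l).2.1 u hu, zero_mul]
      · field_simp
    rw [this]
    exact (hg k l).1

namespace IsContVersion

variable {ψ : EuclideanSpace ℝ (Fin p)} {f : ℝ → ℝ}
  {M : ℝ → Matrix (Fin p ⊕ Unit) (Fin p ⊕ Unit) ℝ}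

lemma density_mul (hv : IsContVersion μ X ψ f M) (hX : Measurable X) (hX2 : MemLp X 2 μ)
    {φ : ℝ → ℝ} (hφ : Measurable φ) (k l : Fin p ⊕ Unit)
    (hi : Integrable (fun ω => φ (lin ψ (X ω)) * (star (X ω) k * star (X ω) l)) μ) :
    IsWeightedDensity μ (fun ω => lin ψ (X ω))
      (fun ω => φ (lin ψ (X ω)) * (star (X ω) k * star (X ω) l)) volume
      fun u => φ u * (f u * M u k l) := by
  simpa only [mul_comm (M _ k l) (f _)] using
    IsWeightedDensity.of_isCondMean (measurable_lin hX ψ) hv.1.1 hv.1.2.1 hv.1.2.2 (hv.2.1 k l) hφ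
      (integrable_star_mul_star hX2 k l) hi

lemma density (hv : IsContVersion μ X ψ f M) (hX : Measurable X) (hX2 : MemLp X 2 μ)
    (k l : Fin p ⊕ Unit) :
    IsWeightedDensity μ (fun ω => lin ψ (X ω)) (fun ω => star (X ω) k * star (X ω) l) volume
      fun u => f u * M u k l := by
  simpa using hv.density_mul hX hX2 (φ := fun _ => 1) measurable_const k l
    (by simpa using integrable_star_mul_star hX2 k l)

/-- The weighted density of `X*_k` itself; recall that the last coordinate of `X*` is `-1`. -/
lemma density_star (hv : IsContVersion μ X ψ f M) (hX : Measurable X) (hX2 : MemLp X 2 μ)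
    (k : Fin p ⊕ Unit) :
    IsWeightedDensity μ (fun ω => lin ψ (X ω)) (fun ω => star (X ω) k) volume
      fun u => -1 * (f u * M u k (Sum.inr ())) := by
  have := (hv.density hX hX2 k (Sum.inr ())).const_mul (-1)
  simpa [star] using this

lemma density_lin_mul_star (hv : IsContVersion μ X ψ f M) (hX : Measurable X) (hX2 : MemLp X 2 μ)
    (δ : EuclideanSpace ℝ (Fin p)) (k : Fin p ⊕ Unit) :
    IsWeightedDensity μ (fun ω => lin ψ (X ω)) (fun ω => lin δ (X ω) * star (X ω) k) volume
      fun u => ∑ i, δ i * (f u * M u k (Sum.inl i)) := by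
  have := IsWeightedDensity.sum Finset.univ
    (fun i _ => (integrable_star_mul_star hX2 k (Sum.inl i)).const_mul (δ i))
    (fun i _ => (hv.density hX hX2 k (Sum.inl i)).const_mul (δ i))
  convert this using 2 with ω
  rw [lin_eq_sum_star, Finset.sum_mul]
  exact Finset.sum_congr rfl fun i _ => by ring

end IsContVersion

end Versions

/-! ### Derivatives of half-space moments -/

section Halfspace

variable {Ω : Type*} [MeasurableSpace Ω] {p : ℕ} {μ : Measure Ω}

lemma hasDerivAt_setIntegral_Iic {g : ℝ → ℝ} (hg : Integrable g) (hgc : Continuous g) (b : ℝ) :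
    HasDerivAt (fun b => ∫ u in Set.Iic b, g u) (g b) b := by
  have h1 : (fun b => ∫ u in Set.Iic b, g u) =
      fun b => (∫ u in Set.Iic (0 : ℝ), g u) + ∫ u in (0 : ℝ)..b, g u := by
    funext b
    rw [← intervalIntegral.integral_Iic_sub_Iic hg.integrableOn hg.integrableOn]
    ring
  rw [h1]
  exact (hgc.integral_hasStrictDerivAt 0 b).hasDerivAt.const_add _

/-- The mass of the region `{u ≤ b v}` computed fibrewise. -/
lemma IsWeightedDensity.setIntegral_le {V U W : Ω → ℝ} {ρ : Measure ℝ} [SFinite ρ]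
    {g : ℝ → ℝ → ℝ}
    (h : IsWeightedDensity μ (fun ω => (V ω, U ω)) W (ρ.prod volume) fun z => g z.1 z.2)
    {b : ℝ → ℝ} (hb : Measurable b) :
    Integrable (fun v => ∫ u in Set.Iic (b v), g v u) ρ ∧
      ∫ ω in {ω | U ω ≤ b (V ω)}, W ω ∂μ = ∫ v, (∫ u in Set.Iic (b v), g v u) ∂ρ := by
  set B : Set (ℝ × ℝ) := {z | z.2 ≤ b z.1} with hBdef
  have hB : MeasurableSet B := measurableSet_le measurable_snd (hb.comp measurable_fst)
  have h1 := h.2 B hB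
  have hi := h.1.indicator hB
  have hfib : ∀ v, ∫ u, B.indicator (fun z => g z.1 z.2) (v, u) = ∫ u in Set.Iic (b v), g v u :=
    fun v => by
      rw [← integral_indicator measurableSet_Iic]
      rfl
  constructor
  · simpa only [hfib] using hi.integral_prod_left
  · rw [← integral_indicator hB, integral_prod _ hi] at h1
    simp only [hfib] at h1
    exact h1

variable {X : Ω → EuclideanSpace ℝ (Fin p)} {ψ δ : EuclideanSpace ℝ (Fin p)}

/-- Rescaling and translating the half-space `{ψᵀ x ≤ c}`. -/
lemma hasDerivAt_setIntegral_parallel (k : Fin p ⊕ Unit) {g : ℝ → ℝ} (hgc : Continuous g)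
    (hg : IsWeightedDensity μ (fun ω => lin ψ (X ω)) (fun ω => star (X ω) k) volume g)
    (a c s : ℝ) :
    HasDerivAt (fun τ : ℝ =>
        ∫ ω in {ω | lin ψ (X ω) + τ * lin (a • ψ) (X ω) ≤ c + τ * s}, star (X ω) k ∂μ)
      ((s - a * c) * g c) 0 := by
  have hquot : HasDerivAt (fun τ : ℝ => (c + τ * s) / (1 + τ * a)) (s - a * c) 0 := by
    have h1 : HasDerivAt (fun τ : ℝ => c + τ * s) s 0 := by
      simpa using ((hasDerivAt_id (0 : ℝ)).mul_const s).const_add c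
    have h2 : HasDerivAt (fun τ : ℝ => 1 + τ * a) a 0 := by
      simpa using ((hasDerivAt_id (0 : ℝ)).mul_const a).const_add 1
    exact (h1.fun_div h2 (by norm_num)).congr_deriv (by simp; ring)
  have hcomp : HasDerivAt (fun τ : ℝ => ∫ u in Set.Iic ((c + τ * s) / (1 + τ * a)), g u)
      (g c * (s - a * c)) 0 :=
    HasDerivAt.comp (0 : ℝ) (h₂ := fun b => ∫ u in Set.Iic b, g u)
      (by simpa using hasDerivAt_setIntegral_Iic hg.1 hgc c) hquot
  rw [mul_comm]
  refine hcomp.congr_of_eventuallyEq ?_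
  have hpos : ∀ᶠ τ : ℝ in nhds 0, 0 < 1 + τ * a := by
    have : Continuous fun τ : ℝ => 1 + τ * a := by fun_prop
    exact this.continuousAt.eventually (lt_mem_nhds (by norm_num))
  filter_upwards [hpos] with τ hτ
  rw [← hg.2 _ measurableSet_Iic]
  congr 2
  ext ω
  simp only [Set.mem_ofPred_eq, Set.mem_preimage, Set.mem_Iic, lin_smul, le_div_iff₀ hτ]
  constructor <;> intro h <;> linarith

variable [IsFiniteMeasure μ]

/-- Tilting the half-space `{ψᵀ x ≤ c}` in a direction `δ` off the line of `ψ`.  The half-space is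
first translated to the level `c + τ s`, where the continuous density `g` of the `X*_k`-weighted
law of `ψᵀ X` gives the derivative.  What remains is an integral over intervals of length `|τ v|`
in the fibres, for which the bound on `v * h k v u` suffices. -/
lemma IsFiberDensity.hasDerivAt_setIntegral {h : Fin p ⊕ Unit → ℝ → ℝ → ℝ}
    (hh : IsFiberDensity μ X ψ δ h) (k : Fin p ⊕ Unit) {g : ℝ → ℝ} (hgc : Continuous g)
    (hg : IsWeightedDensity μ (fun ω => lin ψ (X ω)) (fun ω => star (X ω) k) volume g)
    (c s : ℝ) :
    HasDerivAt (fun τ : ℝ =>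
        ∫ ω in {ω | lin ψ (X ω) + τ * lin δ (X ω) ≤ c + τ * s}, star (X ω) k ∂μ)
      (s * g c - ∫ v, v * h k v c ∂(μ.map fun ω => lin δ (X ω))) 0 := by
  set ρ := μ.map fun ω => lin δ (X ω) with hρ
  set F : ℝ → ℝ → ℝ := fun τ v => ∫ u in (c + τ * s)..(c + τ * (s - v)), h k v u with hF
  have hb : ∀ τ : ℝ, Measurable fun v : ℝ => c + τ * (s - v) := fun τ => by fun_prop
  have hfib : ∀ᵐ v ∂ρ, Integrable (h k v) := (hh.density k).1.prod_right_ae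
  have hFae : ∀ τ, (fun v => (∫ u in Set.Iic (c + τ * (s - v)), h k v u) -
      ∫ u in Set.Iic (c + τ * s), h k v u) =ᵐ[ρ] F τ := fun τ => by
    filter_upwards [hfib] with v hv
    exact intervalIntegral.integral_Iic_sub_Iic hv.integrableOn hv.integrableOn
  have hFi : ∀ τ, Integrable (F τ) ρ := fun τ =>
    (((hh.density k).setIntegral_le (hb τ)).1.sub
      ((hh.density k).setIntegral_le (b := fun _ => c + τ * s) measurable_const).1).congr (hFae τ)
  have hsplit : (fun τ : ℝ =>
      ∫ ω in {ω | lin ψ (X ω) + τ * lin δ (X ω) ≤ c + τ * s}, star (X ω) k ∂μ) =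
      fun τ => (∫ u in Set.Iic (c + τ * s), g u) + ∫ v, F τ v ∂ρ := by
    funext τ
    obtain ⟨hi1, he1⟩ := (hh.density k).setIntegral_le (hb τ)
    obtain ⟨hi2, he2⟩ := (hh.density k).setIntegral_le (b := fun _ => c + τ * s) measurable_const
    have h3 := hg.2 (Set.Iic (c + τ * s)) measurableSet_Iic
    have h4 : {ω | lin ψ (X ω) + τ * lin δ (X ω) ≤ c + τ * s} =
        {ω | lin ψ (X ω) ≤ c + τ * (s - lin δ (X ω))} := by
      ext ω
      simp only [Set.mem_ofPred_eq]
      constructor <;> intro h5 <;> linarith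
    have h5 : (fun ω => lin ψ (X ω)) ⁻¹' Set.Iic (c + τ * s) = {ω | lin ψ (X ω) ≤ c + τ * s} := rfl
    have h6 : ∫ v, F τ v ∂ρ = (∫ ω in {ω | lin ψ (X ω) ≤ c + τ * (s - lin δ (X ω))},
        star (X ω) k ∂μ) - ∫ ω in {ω | lin ψ (X ω) ≤ c + τ * s}, star (X ω) k ∂μ := by
      rw [he1, he2]
      exact (integral_congr_ae (hFae τ)).symm.trans (integral_sub hi1 hi2)
    rw [h6, h4, ← h3, h5]
    ring
  have hF0 : ∀ v, F 0 v = 0 := fun v => by simp [hF]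
  have hderiv : ∀ v, HasDerivAt (fun τ => F τ v) (-(v * h k v c)) 0 := fun v => by
    have hΨ : HasDerivAt (fun b => ∫ u in c..b, h k v u) (h k v c) c :=
      ((hh.continuous k v).integral_hasStrictDerivAt c c).hasDerivAt
    have hline : ∀ w : ℝ, HasDerivAt (fun τ : ℝ => c + τ * w) w 0 := fun w => by
      simpa using ((hasDerivAt_id (0 : ℝ)).mul_const w).const_add c
    have hcomp : ∀ w : ℝ, HasDerivAt (fun τ : ℝ => ∫ u in c..(c + τ * w), h k v u)
        (h k v c * w) 0 := fun w =>
      HasDerivAt.comp (0 : ℝ) (h₂ := fun b => ∫ u in c..b, h k v u)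
        (by simpa using hΨ) (hline w)
    have h1 := (hcomp (s - v)).sub (hcomp s)
    have h2 : (fun τ => F τ v) = (fun τ : ℝ => ∫ u in c..(c + τ * (s - v)), h k v u) -
        fun τ : ℝ => ∫ u in c..(c + τ * s), h k v u := by
      funext τ
      have hi : ∀ a b, IntervalIntegrable (h k v) volume a b := fun a b =>
        (hh.continuous k v).intervalIntegrable a b
      simp only [hF, Pi.sub_apply]
      rw [intervalIntegral.integral_interval_sub_left (hi _ _) (hi _ _)]
    rw [h2]
    exact h1.congr_deriv (by ring)
  obtain ⟨C, hCi, hCb⟩ := hh.bound_mul k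
  have hlip : ∀ᵐ v ∂ρ, ∀ τ ∈ (Set.univ : Set ℝ), ‖F τ v - F 0 v‖ ≤ C v * ‖τ - 0‖ := by
    filter_upwards [hCb] with v hv τ _
    rw [hF0, sub_zero, sub_zero, Real.norm_eq_abs τ]
    have hlen : c + τ * (s - v) - (c + τ * s) = -(τ * v) := by ring
    rcases eq_or_ne v 0 with rfl | hv0
    · have h1 : F τ 0 = 0 := by simp [hF]
      rw [h1, norm_zero]
      exact mul_nonneg ((abs_nonneg _).trans (hv 0)) (abs_nonneg _)
    · have h1 : ‖F τ v‖ ≤ C v / |v| * |c + τ * (s - v) - (c + τ * s)| :=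
        intervalIntegral.norm_integral_le_of_norm_le_const fun u _ => by
          rw [le_div_iff₀ (abs_pos.2 hv0), Real.norm_eq_abs, mul_comm, ← abs_mul]
          exact hv u
      rw [hlen, abs_neg, abs_mul] at h1
      refine h1.trans (le_of_eq ?_)
      have := abs_pos.2 hv0
      field_simp
  have hmeas : Measurable fun v => -(v * h k v c) :=
    (measurable_id.mul (hh.measurable_left k c)).neg
  have hmain := (hasFDerivAt_integral_of_dominated_loc_of_lip' (𝕜 := ℝ) (x₀ := (0 : ℝ))
    (F' := fun v => ContinuousLinearMap.toSpanSingleton ℝ (-(v * h k v c)))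
    Filter.univ_mem (fun τ _ => (hFi τ).aestronglyMeasurable) (hFi 0)
    ((ContinuousLinearMap.toSpanSingletonCLE (𝕜 := ℝ) (E := ℝ)).continuous.comp_aestronglyMeasurable
      hmeas.aestronglyMeasurable) hlip hCi
    (Filter.Eventually.of_forall fun v => (hderiv v).hasFDerivAt))
  have h2 := hmain.2.hasDerivAt
  rw [ContinuousLinearMap.integral_apply hmain.1] at h2
  simp only [ContinuousLinearMap.toSpanSingleton_apply, one_smul, integral_neg] at h2
  have h1 : HasDerivAt (fun τ : ℝ => ∫ u in Set.Iic (c + τ * s), g u) (g c * s) 0 := by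
    have hline : HasDerivAt (fun τ : ℝ => c + τ * s) s 0 := by
      simpa using ((hasDerivAt_id (0 : ℝ)).mul_const s).const_add c
    exact HasDerivAt.comp (0 : ℝ) (h₂ := fun b => ∫ u in Set.Iic b, g u)
      (by simpa using hasDerivAt_setIntegral_Iic hg.1 hgc c) hline
  rw [hsplit]
  exact (h1.add h2).congr_deriv (by ring)

/-- The directional derivative of `E[X*_k 1{ψᵀ X ≤ c}]` in an arbitrary direction `(δ, s)`,
expressed by continuous versions of the density and of the conditional second moments. -/
lemma IsContVersion.hasDerivAt_setIntegral (hX : Measurable X) (hX2 : MemLp X 2 μ) (hψ : ψ ≠ 0)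
    (hreg : ∀ δ, LinearIndependent ℝ ![ψ, δ] → ∃ h, IsFiberDensity μ X ψ δ h)
    {f : ℝ → ℝ} {M : ℝ → Matrix (Fin p ⊕ Unit) (Fin p ⊕ Unit) ℝ} (hv : IsContVersion μ X ψ f M)
    (k : Fin p ⊕ Unit) (δ : EuclideanSpace ℝ (Fin p)) (c s : ℝ) :
    HasDerivAt (fun τ : ℝ =>
        ∫ ω in {ω | lin ψ (X ω) + τ * lin δ (X ω) ≤ c + τ * s}, star (X ω) k ∂μ)
      (-((∑ i, δ i * (f c * M c k (Sum.inl i))) + s * (f c * M c k (Sum.inr ())))) 0 := by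
  have hgc : ∀ l, Continuous fun u => -1 * (f u * M u k l) := fun l =>
    continuous_const.mul (hv.continuous_entry k l)
  have hsum : Continuous fun u => ∑ i, δ i * (f u * M u k (Sum.inl i)) :=
    continuous_finsetSum _ fun i _ => continuous_const.mul (hv.continuous_entry k _)
  by_cases hδ : LinearIndependent ℝ ![ψ, δ]
  · obtain ⟨h, hh⟩ := hreg δ hδ
    have h1 := (hh.density_mul k).marginal.eq_of_continuous (hv.density_lin_mul_star hX hX2 δ k)
      (hh.continuous_integral_mul k) hsum
    have h2 := hh.hasDerivAt_setIntegral k (hgc _) (hv.density_star hX hX2 k) c s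
    rw [congrFun h1 c] at h2
    exact h2.congr_deriv (by ring)
  · rw [LinearIndependent.pair_iff' hψ] at hδ
    push Not at hδ
    obtain ⟨a, rfl⟩ := hδ
    have h1 := hasDerivAt_setIntegral_parallel k (hgc _) (hv.density_star hX hX2 k) a c s
    -- here `δᵀ X = a U`, so the weighted density of `δᵀ X X*_k` is `a u` times that of `X*_k`
    have hi : Integrable (fun ω => lin ψ (X ω) * (star (X ω) k * star (X ω) (Sum.inr ()))) μ := by
      simpa [star] using (integrable_lin_mul_star hX2 ψ k).neg
    have h2 := (hv.density_mul hX hX2 measurable_id k (Sum.inr ()) hi).const_mul (-a)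
    have h3 : IsWeightedDensity μ (fun ω => lin ψ (X ω))
        (fun ω => lin (a • ψ) (X ω) * star (X ω) k) volume
        fun u => -a * (u * (f u * M u k (Sum.inr ()))) := by
      convert h2 using 2 with ω
      · simp only [lin_smul, star, Sum.elim_inr, id]
        ring
      · rfl
    have h4 := congrFun ((hv.density_lin_mul_star hX hX2 (a • ψ) k).eq_of_continuous h3 hsum
      (continuous_const.mul (continuous_id.mul (hv.continuous_entry k _)))) c
    simp only at h4
    exact h1.congr_deriv (by rw [h4]; ring)

end Halfspace

/-! ### The gradient of the objective function -/

section Gradient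

variable {Ω : Type*} [MeasurableSpace Ω] {p : ℕ}

/-- The augmented vector `x*` as an element of the Euclidean parameter space. -/
def starVec (x : EuclideanSpace ℝ (Fin p)) : Param p := WithLp.toLp 2 (star x)

/-- The vector `E[X* 1{ψᵀ X ≤ t + y}]`, where `θ = (ψ, t)`. -/
noncomputable def halfMoment (μ : Measure Ω) (X : Ω → EuclideanSpace ℝ (Fin p)) (y : ℝ) (θ : Param p) :
    Param p :=
  WithLp.toLp 2 fun k => ∫ ω in {ω | lin (normal θ) (X ω) ≤ offset θ + y}, star (X ω) k ∂μ

lemma inner_starVec (x : EuclideanSpace ℝ (Fin p)) (θ : Param p) :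
    inner ℝ (starVec x) θ = lin (normal θ) x - offset θ := by
  simp [starVec, PiLp.inner_apply, Fintype.sum_sum_type, star, lin, normal, offset, sub_eq_add_neg]

lemma integrable_starVec {μ : Measure Ω} [IsFiniteMeasure μ] {X : Ω → EuclideanSpace ℝ (Fin p)}
    (hX2 : MemLp X 2 μ) : Integrable (fun ω => starVec (X ω)) μ :=
  integrable_piLp_iff.2 fun k => integrable_star hX2 k

lemma IsDensity.ae_ne {μ : Measure Ω} {U : Ω → ℝ} {f : ℝ → ℝ} (h : IsDensity μ U f)
    (hU : Measurable U) (c : ℝ) : ∀ᵐ ω ∂μ, U ω ≠ c := by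
  have h1 : μ.map U ≪ volume := by
    rw [h.2.2]
    exact withDensity_absolutelyContinuous _ _
  have h2 : μ.map U {c} = 0 := h1 Real.volume_singleton
  rw [Measure.map_apply hU (measurableSet_singleton c)] at h2
  exact measure_eq_zero_iff_ae_notMem.1 h2

/-- The expected hinge loss in the class `y` is differentiable at `θ = (ψ, t)` when `ψᵀ X` has no
atom at `t + y`.  For both `y = 1` and `y = -1` the derivative of the hinge loss is
`((1 - y) / 2 - 1{ψᵀ x ≤ t + y}) x*` off that atom. -/
lemma hasGradientAt_hinge {μ : Measure Ω} [IsFiniteMeasure μ] {X : Ω → EuclideanSpace ℝ (Fin p)}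
    (hX : Measurable X) (hX2 : MemLp X 2 μ) {y : ℝ} (hy : y = -1 ∨ y = 1) {θ : Param p}
    (hatom : ∀ᵐ ω ∂μ, lin (normal θ) (X ω) ≠ offset θ + y) :
    HasGradientAt (fun θ => ∫ ω, max (1 - y * (lin (normal θ) (X ω) - offset θ)) 0 ∂μ)
      (((1 - y) / 2) • (∫ ω, starVec (X ω) ∂μ) - halfMoment μ X y θ) θ := by
  set A : Set Ω := {ω | lin (normal θ) (X ω) ≤ offset θ + y} with hA
  have hAm : MeasurableSet A := measurableSet_le (measurable_lin hX _) measurable_const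
  set w : Ω → Param p := fun ω => ((1 - y) / 2) • starVec (X ω) - A.indicator
    (fun ω => starVec (X ω)) ω with hw
  have hsi := integrable_starVec hX2
  have hwi : Integrable w μ := (hsi.smul ((1 - y) / 2)).sub (hsi.indicator hAm)
  have hwint : ∫ ω, w ω ∂μ =
      ((1 - y) / 2) • (∫ ω, starVec (X ω) ∂μ) - halfMoment μ X y θ := by
    have h1 : ∫ ω, w ω ∂μ = (∫ ω, ((1 - y) / 2) • starVec (X ω) ∂μ) -
        ∫ ω, A.indicator (fun ω => starVec (X ω)) ω ∂μ :=
      integral_sub (hsi.smul ((1 - y) / 2)) (hsi.indicator hAm)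
    rw [h1, integral_smul, integral_indicator hAm]
    congr 1
    ext k
    exact eval_integral_piLp (f := fun ω => starVec (X ω))
      (fun k => (integrable_star hX2 k).integrableOn) k
  have hy2 : |y| = 1 := by rcases hy with rfl | rfl <;> norm_num
  have hmeas : ∀ θ : Param p,
      Measurable fun ω => max (1 - y * inner ℝ (starVec (X ω)) θ) 0 := fun θ => by
    simp only [inner_starVec]
    exact (measurable_const.sub
      (measurable_const.mul ((measurable_lin hX _).sub measurable_const))).max measurable_const
  have hlip : ∀ (x : EuclideanSpace ℝ (Fin p)) (θ θ' : Param p),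
      |max (1 - y * inner ℝ (starVec x) θ) 0 - max (1 - y * inner ℝ (starVec x) θ') 0| ≤
        ‖starVec x‖ * ‖θ - θ'‖ := fun x θ θ' => by
    refine (abs_max_sub_max_le_abs _ _ _).trans ?_
    have h1 : 1 - y * inner ℝ (starVec x) θ - (1 - y * inner ℝ (starVec x) θ') =
        -(y * inner ℝ (starVec x) (θ - θ')) := by
      rw [inner_sub_right]; ring
    rw [h1, abs_neg, abs_mul, hy2, one_mul]
    exact abs_real_inner_le_norm _ _
  have hmain := (hasFDerivAt_integral_of_dominated_loc_of_lip' (𝕜 := ℝ) (μ := μ) (x₀ := θ)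
    (F := fun θ ω => max (1 - y * inner ℝ (starVec (X ω)) θ) 0)
    (bound := fun ω => ‖starVec (X ω)‖) (F' := fun ω => innerSL ℝ (w ω))
    Filter.univ_mem (fun θ _ => (hmeas θ).aestronglyMeasurable) ?_
    ((innerSL ℝ).continuous.comp_aestronglyMeasurable hwi.aestronglyMeasurable)
    (Filter.Eventually.of_forall fun ω θ' _ => hlip (X ω) θ' θ) hsi.norm ?_).2
  · rw [hasGradientAt_iff_hasFDerivAt, ← hwint]
    simp only [inner_starVec] at hmain
    rwa [ContinuousLinearMap.integral_comp_comm (innerSL ℝ) hwi] at hmain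
  · refine ((integrable_const (1 : ℝ)).add (hsi.norm.mul_const ‖θ‖)).mono'
      (hmeas θ).aestronglyMeasurable (Filter.Eventually.of_forall fun ω => ?_)
    have h1 := hlip (X ω) θ 0
    simp only [inner_zero_right, mul_zero, sub_zero, max_eq_left (zero_le_one' ℝ)] at h1
    have h2 := abs_le.1 h1
    rw [Real.norm_eq_abs, abs_of_nonneg (le_max_right _ _)]
    simp only [Pi.add_apply]
    linarith
  · filter_upwards [hatom] with ω hω
    have haff : HasFDerivAt (fun θ : Param p => 1 - y * inner ℝ (starVec (X ω)) θ)
        (-(y • innerSL ℝ (starVec (X ω)))) θ :=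
      (((innerSL ℝ (starVec (X ω))).hasFDerivAt (x := θ)).const_mul y).const_sub 1
    have hval : 1 - y * inner ℝ (starVec (X ω)) θ =
        y * (offset θ + y - lin (normal θ) (X ω)) := by
      rw [inner_starVec]
      rcases hy with rfl | rfl <;> ring
    rcases lt_or_gt_of_ne hω with hlt | hgt
    · have hωA : ω ∈ A := hlt.le
      rcases hy with rfl | rfl
      · have hneg : 1 - -1 * inner ℝ (starVec (X ω)) θ < 0 := by rw [hval]; linarith
        have h0 : innerSL ℝ (w ω) = 0 := by
          simp only [hw, Set.indicator_of_mem hωA]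
          norm_num
        rw [h0]
        refine (hasFDerivAt_const (0 : ℝ) θ).congr_of_eventuallyEq ?_
        filter_upwards [haff.continuousAt.eventually (gt_mem_nhds hneg)] with θ' h'
        exact max_eq_right h'.le
      · have hpos : 0 < 1 - 1 * inner ℝ (starVec (X ω)) θ := by rw [hval]; linarith
        have h0 : innerSL ℝ (w ω) = -((1 : ℝ) • innerSL ℝ (starVec (X ω))) := by
          simp only [hw, Set.indicator_of_mem hωA]
          norm_num
        rw [h0]
        refine haff.congr_of_eventuallyEq ?_
        filter_upwards [haff.continuousAt.eventually (lt_mem_nhds hpos)] with θ' h'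
        exact max_eq_left h'.le
    · have hωA : ω ∉ A := not_le.2 hgt
      rcases hy with rfl | rfl
      · have hpos : 0 < 1 - -1 * inner ℝ (starVec (X ω)) θ := by rw [hval]; linarith
        have h0 : innerSL ℝ (w ω) = -((-1 : ℝ) • innerSL ℝ (starVec (X ω))) := by
          simp only [hw, Set.indicator_of_notMem hωA]
          norm_num
        rw [h0]
        refine haff.congr_of_eventuallyEq ?_
        filter_upwards [haff.continuousAt.eventually (lt_mem_nhds hpos)] with θ' h'
        exact max_eq_left h'.le
      · have hneg : 1 - 1 * inner ℝ (starVec (X ω)) θ < 0 := by rw [hval]; linarith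
        have h0 : innerSL ℝ (w ω) = 0 := by
          simp only [hw, Set.indicator_of_notMem hωA]
          norm_num
        rw [h0]
        refine (hasFDerivAt_const (0 : ℝ) θ).congr_of_eventuallyEq ?_
        filter_upwards [haff.continuousAt.eventually (gt_mem_nhds hneg)] with θ' h'
        exact max_eq_right h'.le

lemma quadraticForm_eq_inner (S : Matrix (Fin p) (Fin p) ℝ) (θ : Param p) :
    ∑ i, ∑ j, normal θ i * S i j * normal θ j =
      inner ℝ θ (Matrix.toEuclideanCLM (𝕜 := ℝ) (augment S) θ) := by
  simp only [PiLp.inner_apply, Fintype.sum_sum_type, Matrix.ofLp_toEuclideanCLM, Matrix.mulVec,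
    dotProduct, augment, normal, Matrix.fromBlocks_apply₁₁, Matrix.fromBlocks_apply₁₂,
    Matrix.fromBlocks_apply₂₁, Matrix.fromBlocks_apply₂₂, Matrix.zero_apply, zero_mul,
    Finset.sum_const_zero, add_zero, RCLike.inner_apply, conj_trivial, Finset.sum_mul]
  exact Finset.sum_congr rfl fun i _ => Finset.sum_congr rfl fun j _ => by ring

lemma hasGradientAt_quadraticForm {S : Matrix (Fin p) (Fin p) ℝ} (hS : Sᵀ = S) (θ : Param p) :
    HasGradientAt (fun θ : Param p => ∑ i, ∑ j, normal θ i * S i j * normal θ j)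
      (Matrix.toEuclideanCLM (𝕜 := ℝ) ((2 : ℝ) • augment S) θ) θ := by
  simp only [quadraticForm_eq_inner]
  set A := Matrix.toEuclideanCLM (𝕜 := ℝ) (augment S) with hA
  have hsymm : Star.star A = A := by
    rw [hA, ← map_star, Matrix.star_eq_conjTranspose, augment, Matrix.fromBlocks_conjTranspose]
    simp [hS]
  rw [hasGradientAt_iff_hasFDerivAt]
  refine ((hasFDerivAt_id θ).inner ℝ A.hasFDerivAt).congr_fderiv ?_
  ext η
  have h1 : inner ℝ θ (A η) = inner ℝ (A θ) η := by
    conv_lhs => rw [← hsymm, ContinuousLinearMap.star_eq_adjoint,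
      ContinuousLinearMap.adjoint_inner_right]
  simp [h1, ← hA, real_inner_comm η, two_mul]

section Slice

variable {P : Measure Ω} {Y : Ω → ℝ}

lemma memLp_slice {X : Ω → EuclideanSpace ℝ (Fin p)} (hX2 : MemLp X 2 P) (y : ℝ) :
    MemLp X 2 (slice P Y y) := by
  by_cases h : P (Y ⁻¹' {y}) = 0
  · rw [slice, cond_eq_zero_of_meas_eq_zero h]
    exact memLp_measure_zero
  · exact (hX2.restrict _).smul_measure (ENNReal.inv_ne_top.2 h)

variable [IsProbabilityMeasure P]

instance (y : ℝ) : IsFiniteMeasure (slice P Y y) := by unfold slice; infer_instance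

lemma restrict_eq_smul_slice (y : ℝ) :
    P.restrict (Y ⁻¹' {y}) = P (Y ⁻¹' {y}) • slice P Y y := by
  rw [slice, ProbabilityTheory.cond, smul_smul]
  by_cases h : P (Y ⁻¹' {y}) = 0
  · rw [h, zero_mul, zero_smul, Measure.restrict_eq_zero.2 h]
  · rw [ENNReal.mul_inv_cancel h (measure_ne_top _ _), one_smul]

/-- Total expectation over the two classes. -/
lemma integral_eq_sum_slice (hY : Measurable Y) (hY1 : ∀ᵐ ω ∂P, Y ω = -1 ∨ Y ω = 1)
    {G : ℝ → Ω → ℝ} (hG : ∀ y, Integrable (G y) P) :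
    Integrable (fun ω => G (Y ω) ω) P ∧ ∫ ω, G (Y ω) ω ∂P =
      ∑ y ∈ ({-1, 1} : Finset ℝ), P.real (Y ⁻¹' {y}) * ∫ ω, G y ω ∂(slice P Y y) := by
  have hm : ∀ y, MeasurableSet (Y ⁻¹' {y}) := fun y => hY (measurableSet_singleton y)
  have heq : ∀ y, Set.EqOn (fun ω => G (Y ω) ω) (G y) (Y ⁻¹' {y}) := fun y ω hω => by
    have : Y ω = y := hω
    simp only [this]
  have hon : ∀ y, IntegrableOn (fun ω => G (Y ω) ω) (Y ⁻¹' {y}) P := fun y =>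
    (integrableOn_congr_fun (heq y) (hm y)).2 (hG y).integrableOn
  have huniv : P.restrict (Y ⁻¹' {-1} ∪ Y ⁻¹' {1}) = P :=
    Measure.restrict_eq_self_of_ae_mem hY1
  have hval : ∀ y, ∫ ω in Y ⁻¹' {y}, G (Y ω) ω ∂P =
      P.real (Y ⁻¹' {y}) * ∫ ω, G y ω ∂(slice P Y y) := fun y => by
    rw [setIntegral_congr_fun (hm y) (heq y), restrict_eq_smul_slice, integral_smul_measure]
    rfl
  have hdisj : Disjoint (Y ⁻¹' {-1}) (Y ⁻¹' {1}) := by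
    refine Disjoint.preimage _ ?_
    rw [Set.disjoint_singleton]
    norm_num
  constructor
  · have := (hon (-1)).union (hon 1)
    rwa [IntegrableOn, huniv] at this
  · rw [Finset.sum_pair (by norm_num), ← hval, ← hval,
      ← setIntegral_union hdisj (hm 1) (hon _) (hon _), huniv]

end Slice

/-- The gradient of the objective function in closed form. -/
noncomputable def riskGradient (P : Measure Ω) (X : Ω → EuclideanSpace ℝ (Fin p)) (Y : Ω → ℝ) (lam : ℝ)
    (θ : Param p) : Param p :=
  Matrix.toEuclideanCLM (𝕜 := ℝ) ((2 : ℝ) • augment (covMat P X)) θ +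
    lam • ∑ y ∈ ({-1, 1} : Finset ℝ), P.real (Y ⁻¹' {y}) •
      (((1 - y) / 2) • (∫ ω, starVec (X ω) ∂(slice P Y y)) - halfMoment (slice P Y y) X y θ)

lemma covMat_transpose (P : Measure Ω) (X : Ω → EuclideanSpace ℝ (Fin p)) :
    (covMat P X)ᵀ = covMat P X := by
  ext i j
  exact covariance_comm _ _

lemma risk_eq {P : Measure Ω} [IsProbabilityMeasure P] {X : Ω → EuclideanSpace ℝ (Fin p)}
    (hX2 : MemLp X 2 P) {Y : Ω → ℝ} (hY : Measurable Y)
    (hY1 : ∀ᵐ ω ∂P, Y ω = -1 ∨ Y ω = 1) (lam : ℝ) (θ : Param p) :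
    risk P X Y lam θ = (∑ i, ∑ j, normal θ i * covMat P X i j * normal θ j) +
      lam * ∑ y ∈ ({-1, 1} : Finset ℝ), P.real (Y ⁻¹' {y}) *
        ∫ ω, max (1 - y * (lin (normal θ) (X ω) - offset θ)) 0 ∂(slice P Y y) := by
  have hG : ∀ y : ℝ, Integrable
      (fun ω => max (1 - y * (lin (normal θ) (X ω) - offset θ)) 0) P := fun y => by
    have h1 : Integrable (fun ω => 1 - y * (lin (normal θ) (X ω) - offset θ)) P :=
      (integrable_const 1).sub
        ((((memLp_lin hX2 (normal θ)).integrable (by norm_num)).sub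
          (integrable_const (offset θ))).const_mul y)
    exact h1.pos_part
  obtain ⟨hi, he⟩ := integral_eq_sum_slice hY hY1 hG
  unfold risk loss
  rw [integral_add (integrable_const _) (hi.const_mul lam), integral_const_mul, he]
  simp

lemma hasGradientAt_risk {P : Measure Ω} [IsProbabilityMeasure P]
    {X : Ω → EuclideanSpace ℝ (Fin p)} (hX : Measurable X) (hX2 : MemLp X 2 P) {Y : Ω → ℝ}
    (hY : Measurable Y) (hY1 : ∀ᵐ ω ∂P, Y ω = -1 ∨ Y ω = 1) (lam : ℝ) {θ : Param p}
    (hdens : ∀ y ∈ ({-1, 1} : Finset ℝ),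
      ∃ f, IsDensity (slice P Y y) (fun ω => lin (normal θ) (X ω)) f) :
    HasGradientAt (risk P X Y lam) (riskGradient P X Y lam θ) θ := by
  have hrisk := funext fun θ => risk_eq hX2 hY hY1 lam θ
  rw [hrisk, hasGradientAt_iff_hasFDerivAt]
  refine ((hasGradientAt_iff_hasFDerivAt.1
    (hasGradientAt_quadraticForm (covMat_transpose P X) θ)).add
    (HasFDerivAt.const_mul (HasFDerivAt.fun_sum fun y hy =>
      HasFDerivAt.const_mul (?_ : HasFDerivAt _ (InnerProductSpace.toDual ℝ (Param p)
        (((1 - y) / 2) • (∫ ω, starVec (X ω) ∂(slice P Y y)) - halfMoment (slice P Y y) X y θ)) θ)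
        (P.real (Y ⁻¹' {y}))) lam)).congr_fderiv ?_
  · obtain ⟨f, hf⟩ := hdens y hy
    exact hasGradientAt_iff_hasFDerivAt.1 (hasGradientAt_hinge hX (memLp_slice hX2 y)
      (by simpa using hy) (hf.ae_ne (measurable_lin hX _) _))
  · simp only [riskGradient, map_add, LinearIsometryEquiv.map_smulₛₗ, map_sum, conj_trivial]

end Gradient

/-! ### Differentiability of the gradient -/

/-- A field whose derivative in every direction exists near `x` and is given by operators that
depend continuously on the point is Fréchet differentiable at `x`. -/
lemma hasFDerivAt_of_hasLineDerivAt {E F : Type*} [NormedAddCommGroup E] [NormedSpace ℝ E]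
    [NormedAddCommGroup F] [NormedSpace ℝ F] {f : E → F} {f' : E → E →L[ℝ] F} {U : Set E}
    (hU : IsOpen U) (hf : ∀ x ∈ U, ∀ v, HasLineDerivAt ℝ f (f' x v) x v) {x : E} (hx : x ∈ U)
    (hcont : ContinuousAt f' x) : HasFDerivAt f (f' x) x := by
  rw [hasFDerivAt_iff_isLittleO_nhds_zero, Asymptotics.isLittleO_iff]
  intro ε hε
  obtain ⟨r, hr, hball⟩ := Metric.mem_nhds_iff.1
    (Filter.inter_mem (hU.mem_nhds hx) (hcont (Metric.ball_mem_nhds (f' x) hε)))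
  filter_upwards [Metric.ball_mem_nhds (0 : E) hr] with v hv
  have hmem : ∀ s ∈ Set.Icc (0 : ℝ) 1, x + s • v ∈ Metric.ball x r := fun s hs => by
    rw [mem_ball_iff_norm, add_sub_cancel_left, norm_smul, Real.norm_of_nonneg hs.1]
    rw [mem_ball_zero_iff] at hv
    exact (mul_le_of_le_one_left (norm_nonneg v) hs.2).trans_lt hv
  have hderiv : ∀ s ∈ Set.Icc (0 : ℝ) 1, HasDerivWithinAt
      (fun s : ℝ => f (x + s • v) - s • f' x v) (f' (x + s • v) v - f' x v)
      (Set.Icc 0 1) s := fun s hs => by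
    have h1 : HasDerivAt (fun τ : ℝ => f (x + s • v + τ • v)) (f' (x + s • v) v) (s - s) := by
      rw [sub_self]
      exact hf _ (hball (hmem s hs)).1 v
    have h2 := h1.comp_sub_const s s
    have h3 : (fun τ : ℝ => f (x + s • v + (τ - s) • v)) = fun τ : ℝ => f (x + τ • v) := by
      funext τ
      rw [add_assoc, ← add_smul, add_sub_cancel]
    rw [h3] at h2
    have h4 : HasDerivAt (fun s : ℝ => s • f' x v) (f' x v) s := by
      simpa using (hasDerivAt_id s).smul_const (f' x v)
    exact (h2.fun_sub h4).hasDerivWithinAt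
  have hbound : ∀ s ∈ Set.Ico (0 : ℝ) 1, ‖f' (x + s • v) v - f' x v‖ ≤ ε * ‖v‖ := fun s hs => by
    have h1 : f' (x + s • v) ∈ Metric.ball (f' x) ε := (hball (hmem s ⟨hs.1, hs.2.le⟩)).2
    rw [mem_ball_iff_norm] at h1
    exact ((f' (x + s • v) - f' x).le_opNorm v).trans
      (mul_le_mul_of_nonneg_right h1.le (norm_nonneg v))
  have := norm_image_sub_le_of_norm_deriv_le_segment' hderiv hbound 1 (by norm_num)
  simp only [one_smul, zero_smul, add_zero, sub_zero, mul_one] at this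
  rwa [sub_right_comm] at this

section Hessian

variable {Ω : Type*} [MeasurableSpace Ω] {p : ℕ}

lemma continuous_normal : Continuous (normal : Param p → EuclideanSpace ℝ (Fin p)) := by
  unfold normal
  fun_prop

lemma isOpen_normal_ne_zero : IsOpen {θ : Param p | normal θ ≠ 0} :=
  isOpen_ne_fun continuous_normal continuous_const

lemma hasLineDerivAt_halfMoment {μ : Measure Ω} [IsFiniteMeasure μ]
    {X : Ω → EuclideanSpace ℝ (Fin p)} (hX : Measurable X) (hX2 : MemLp X 2 μ) {y : ℝ}
    {θ : Param p} (hθ : normal θ ≠ 0)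
    (hreg : ∀ δ, LinearIndependent ℝ ![normal θ, δ] → ∃ h, IsFiberDensity μ X (normal θ) δ h)
    {f : ℝ → ℝ} {M : ℝ → Matrix (Fin p ⊕ Unit) (Fin p ⊕ Unit) ℝ}
    (hv : IsContVersion μ X (normal θ) f M) (η : Param p) :
    HasLineDerivAt ℝ (halfMoment μ X y)
      (-Matrix.toEuclideanCLM (𝕜 := ℝ) (f (offset θ + y) • M (offset θ + y)) η) θ η := by
  rw [HasLineDerivAt, hasDerivAt_iff_hasFDerivAt, ← hasFDerivWithinAt_univ,
    hasFDerivWithinAt_piLp]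
  intro k
  rw [hasFDerivWithinAt_univ]
  have h1 := (hv.hasDerivAt_setIntegral hX hX2 hθ hreg k (normal η) (offset θ + y)
    (offset η)).hasFDerivAt
  have h2 : (fun τ : ℝ => (halfMoment μ X y (θ + τ • η)) k) = fun τ : ℝ =>
      ∫ ω in {ω | lin (normal θ) (X ω) + τ * lin (normal η) (X ω) ≤
        offset θ + y + τ * offset η}, star (X ω) k ∂μ := by
    funext τ
    have h3 : ∀ x, lin (normal (θ + τ • η)) x = lin (normal θ) x + τ * lin (normal η) x :=
      fun x => by rw [← lin_smul, ← lin_add]; rfl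
    have h4 : offset (θ + τ • η) + y = offset θ + y + τ * offset η := by
      simp only [offset, PiLp.add_apply, PiLp.smul_apply, smul_eq_mul]; ring
    simp only [halfMoment, h3, h4]
  rw [h2]
  refine h1.congr_fderiv ?_
  ext
  simp [Matrix.mulVec, dotProduct, Fintype.sum_sum_type, normal, offset, mul_add, Finset.mul_sum,
    add_comm, mul_assoc, mul_comm]

lemma hasLineDerivAt_riskGradient {P : Measure Ω} [IsProbabilityMeasure P]
    {X : Ω → EuclideanSpace ℝ (Fin p)} (hX : Measurable X) (hX2 : MemLp X 2 P) {Y : Ω → ℝ}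
    (lam : ℝ) {f : ℝ → EuclideanSpace ℝ (Fin p) → ℝ → ℝ}
    {M : ℝ → EuclideanSpace ℝ (Fin p) → ℝ → Matrix (Fin p ⊕ Unit) (Fin p ⊕ Unit) ℝ}
    {θ : Param p} (hθ : normal θ ≠ 0)
    (hreg : ∀ y ∈ ({-1, 1} : Finset ℝ), ∀ δ, LinearIndependent ℝ ![normal θ, δ] →
      ∃ h, IsFiberDensity (slice P Y y) X (normal θ) δ h)
    (hv : ∀ y ∈ ({-1, 1} : Finset ℝ),
      IsContVersion (slice P Y y) X (normal θ) (f y (normal θ)) (M y (normal θ))) (η : Param p) :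
    HasLineDerivAt ℝ (riskGradient P X Y lam)
      (Matrix.toEuclideanCLM (𝕜 := ℝ) (hessian P X Y lam f M θ) η) θ η := by
  have hquad : HasLineDerivAt ℝ
      (fun θ => Matrix.toEuclideanCLM (𝕜 := ℝ) ((2 : ℝ) • augment (covMat P X)) θ)
      (Matrix.toEuclideanCLM (𝕜 := ℝ) ((2 : ℝ) • augment (covMat P X)) η) θ η :=
    (ContinuousLinearMap.hasFDerivAt _).hasLineDerivAt η
  have hterm : ∀ y ∈ ({-1, 1} : Finset ℝ), HasDerivAt (fun τ : ℝ => P.real (Y ⁻¹' {y}) •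
      (((1 - y) / 2) • (∫ ω, starVec (X ω) ∂(slice P Y y)) -
        halfMoment (slice P Y y) X y (θ + τ • η)))
      (P.real (Y ⁻¹' {y}) • Matrix.toEuclideanCLM (𝕜 := ℝ)
        (f y (normal θ) (offset θ + y) • M y (normal θ) (offset θ + y)) η) 0 := fun y hy => by
    have h1 : HasDerivAt _ _ _ :=
      hasLineDerivAt_halfMoment hX (memLp_slice hX2 y) (y := y) hθ (hreg y hy) (hv y hy) η
    have h2 := (h1.const_sub
      (((1 - y) / 2) • (∫ ω, starVec (X ω) ∂(slice P Y y)))).const_smul (P.real (Y ⁻¹' {y}))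
    rwa [neg_neg] at h2
  have h3 := HasDerivAt.fun_add hquad ((HasDerivAt.fun_sum hterm).const_smul lam)
  refine HasDerivAt.congr_deriv (f := fun τ : ℝ => riskGradient P X Y lam (θ + τ • η)) h3 ?_
  rw [hessian]
  simp only [map_add, map_smul, map_sum, add_apply, smul_apply, sum_apply]

end Hessian

end PSVM

theorem theorem5 {Ω : Type*} [MeasurableSpace Ω] (P : Measure Ω) [IsProbabilityMeasure P]
    {p : ℕ} (hp : 2 ≤ p)
    (X : Ω → EuclideanSpace ℝ (Fin p)) (hX : Measurable X) (hX2 : MemLp X 2 P)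
    (Y : Ω → ℝ) (hY : Measurable Y) (hY1 : ∀ᵐ ω ∂P, Y ω = -1 ∨ Y ω = 1)
    (lam : ℝ) (hlam : 0 < lam)
    (hsupp : PSVM.HasConvexOpenSupport P X)
    (hdom : ∀ y ∈ ({-1, 1} : Finset ℝ), (PSVM.slice P Y y).map X ≪ volume)
    (hreg : ∀ ψ δ : EuclideanSpace ℝ (Fin p), LinearIndependent ℝ ![ψ, δ] →
      ∀ y ∈ ({-1, 1} : Finset ℝ), PSVM.Regular (PSVM.slice P Y y) X ψ δ) :
    -- the gradient of the objective function exists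
    (∀ θ : PSVM.Param p, PSVM.normal θ ≠ 0 →
      DifferentiableAt ℝ (PSVM.risk P X Y lam) θ) ∧
    -- the densities and conditional means in the Hessian have versions with a continuous product
    (∀ y ∈ ({-1, 1} : Finset ℝ), ∀ ψ : EuclideanSpace ℝ (Fin p), ψ ≠ 0 →
      ∃ f M, PSVM.IsContVersion (PSVM.slice P Y y) X ψ f M) ∧
    -- and for all such versions the two differentiability claims hold
    ∀ (f : ℝ → EuclideanSpace ℝ (Fin p) → ℝ → ℝ)
      (M : ℝ → EuclideanSpace ℝ (Fin p) → ℝ → Matrix (Fin p ⊕ Unit) (Fin p ⊕ Unit) ℝ),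
      (∀ y ∈ ({-1, 1} : Finset ℝ), ∀ ψ : EuclideanSpace ℝ (Fin p), ψ ≠ 0 →
        PSVM.IsContVersion (PSVM.slice P Y y) X ψ (f y ψ) (M y ψ)) →
      (∀ θ : PSVM.Param p, PSVM.normal θ ≠ 0 → ∀ η : PSVM.Param p,
        HasLineDerivAt ℝ (gradient (PSVM.risk P X Y lam))
          (Matrix.toEuclideanCLM (𝕜 := ℝ) (PSVM.hessian P X Y lam f M θ) η) θ η) ∧
      ((∀ y ∈ ({-1, 1} : Finset ℝ),
        ContinuousOn
          (fun θ : PSVM.Param p => f y (PSVM.normal θ) (PSVM.offset θ + y) •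
            M y (PSVM.normal θ) (PSVM.offset θ + y))
          {θ | PSVM.normal θ ≠ 0}) →
        ∀ θ : PSVM.Param p, PSVM.normal θ ≠ 0 →
          HasFDerivAt (gradient (PSVM.risk P X Y lam))
            (Matrix.toEuclideanCLM (𝕜 := ℝ) (PSVM.hessian P X Y lam f M θ)) θ) := by
  have hfib : ∀ y ∈ ({-1, 1} : Finset ℝ), ∀ ψ δ : EuclideanSpace ℝ (Fin p),
      LinearIndependent ℝ ![ψ, δ] → ∃ h, PSVM.IsFiberDensity (PSVM.slice P Y y) X ψ δ h :=
    fun y hy ψ δ hδ => (hreg ψ δ hδ y hy).exists_isFiberDensity hX (PSVM.memLp_slice hX2 y)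
      (hreg ψ (-δ) (LinearIndependent.pair_neg_right_iff.2 hδ) y hy)
  have hver : ∀ y ∈ ({-1, 1} : Finset ℝ), ∀ ψ : EuclideanSpace ℝ (Fin p), ψ ≠ 0 →
      ∃ f M, PSVM.IsContVersion (PSVM.slice P Y y) X ψ f M := fun y hy ψ hψ =>
    PSVM.exists_isContVersion hp hX (PSVM.memLp_slice hX2 y) hψ (hfib y hy ψ)
  have hgrad : ∀ θ : PSVM.Param p, PSVM.normal θ ≠ 0 →
      HasGradientAt (PSVM.risk P X Y lam) (PSVM.riskGradient P X Y lam θ) θ := fun θ hθ =>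
    PSVM.hasGradientAt_risk hX hX2 hY hY1 lam fun y hy => by
      obtain ⟨f, M, hv⟩ := hver y hy _ hθ
      exact ⟨f, hv.1⟩
  refine ⟨fun θ hθ => (hgrad θ hθ).differentiableAt, hver, fun f M hfM => ?_⟩
  have hline : ∀ θ : PSVM.Param p, PSVM.normal θ ≠ 0 → ∀ η : PSVM.Param p,
      HasLineDerivAt ℝ (gradient (PSVM.risk P X Y lam))
        (Matrix.toEuclideanCLM (𝕜 := ℝ) (PSVM.hessian P X Y lam f M θ) η) θ η := fun θ hθ η =>
    (PSVM.hasLineDerivAt_riskGradient hX hX2 lam hθ (fun y hy => hfib y hy _)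
      (fun y hy => hfM y hy _ hθ) η).congr_of_eventuallyEq
      (Filter.eventuallyEq_of_mem (PSVM.isOpen_normal_ne_zero.mem_nhds hθ)
        fun θ' hθ' => (hgrad θ' hθ').gradient)
  refine ⟨hline, fun hcont θ hθ => ?_⟩
  refine PSVM.hasFDerivAt_of_hasLineDerivAt
    (f' := fun θ => Matrix.toEuclideanCLM (𝕜 := ℝ) (PSVM.hessian P X Y lam f M θ))
    PSVM.isOpen_normal_ne_zero (fun θ hθ η => hline θ hθ η) hθ ?_
  have hH : ContinuousAt (PSVM.hessian P X Y lam f M) θ := by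
    unfold PSVM.hessian
    refine continuousAt_const.add (Filter.Tendsto.const_smul
      (tendsto_finsetSum _ fun y hy => Filter.Tendsto.const_smul ?_ _) _)
    exact (hcont y hy).continuousAt (PSVM.isOpen_normal_ne_zero.mem_nhds hθ)
  have hL : Continuous fun A : Matrix (Fin p ⊕ Unit) (Fin p ⊕ Unit) ℝ =>
      Matrix.toEuclideanCLM (𝕜 := ℝ) A :=
    LinearMap.continuous_of_finiteDimensional
      (Matrix.toEuclideanCLM (𝕜 := ℝ) (n := Fin p ⊕ Unit)).toAlgEquiv.toLinearMap
  exact hL.continuousAt.comp hH
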